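/- Let $k$ be an algebraically closed field of characteristic zero, $G$ a finite group, and $X$ a smooth projective rational variety over $k$ with a regular right action of $G$ over $k$. For a finite-dimensional (left) representation $V$ of a finite group $H$ over $k$, let $\mathbb{P}(V^\vee)=\operatorname{Proj}(\operatorname{Sym} V)$ be the projective space of lines in $V^\vee$, with the induced right $H$-action. A variety with $H$-action is called $H$-unirational if it admits a dominant $H$-equivariant rational map from $\mathbb{P}(V^\vee)$ for some finite-dimensional representation $V$ of $H$. A central cyclic extension of $G$ is an exact sequence $1\to Z\to\widehat G\xrightarrow{\pi} G\to 1$ of finite groups with $Z$ central in $\widehat G$ and cyclic; given an identification $\chi\colon Z\cong\langle\zeta\rangle\subset k^\times$, where $\zeta$ is a primitive $|Z|$-th root of unity, its class in $H^2(G,k^\times)$ (trivial action on $k^\times$) is the class of the 2-cocycle $(g,h)\mapsto\chi\big(s(g)s(h)s(gh)^{-1}\big)$, for any set-theoretic section $s$ of $\pi$. Fix $\gamma\in H^2(G,k^\times)$, a central cyclic extension $1\to Z\to\widehat G\to G\to 1$ with identification $\chi\colon Z\cong\langle\zeta\rangle$ of class $\gamma$, and a finite-dimensional representation $W\neq 0$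 of $\widehat G$ such that the subgroup of $\widehat G$ acting on $W$ by scalars is precisely $Z$, and each $z\in Z$ acts on $W$ as the scalar $\chi(z)$. Thus $\mathbb{P}((W^{\oplus m})^\vee)$ carries an action of $G=\widehat G/Z$ for every $m\geq 1$. The following are equivalent. (i) There exists a central cyclic extension $\widetilde G$ of $G$ such that $X$ is $\widetilde G$-unirational, where $\widetilde G$ acts on $X$ through $\widetilde G\to G$, and $\widetilde G$ has class $\gamma$ for a suitable identification of $\ker(\widetilde G\to G)$ with a group of roots of unity in $k$. (ii) For some positive integer $m$ there exists a dominant $G$-equivariant rational map $\mathbb{P}((W^{\oplus m})^\vee)\dashrightarrow X$. -/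

import Mathlib

open CategoryTheory AlgebraicGeometry

universe u

namespace EquivUnirational

noncomputable section

/-! ### The symmetric algebra as a graded algebra -/

section SymmetricAlgebra

variable (k V : Type u) [Field k] [AddCommGroup V] [Module k V]

/-- The degree `n` part `Symⁿ V` of the symmetric algebra of `V`: the span of all products of `n`
elements of `V`. -/
def symGrading (n : ℕ) : Submodule k (SymmetricAlgebra k V) :=
  LinearMap.range (SymmetricAlgebra.ι k V) ^ n

lemma ι_mem_symGrading (v : V) : SymmetricAlgebra.ι k V v ∈ symGrading k V 1 := by
  simp [symGrading]

instance symGrading_gradedMonoid : SetLike.GradedMonoid (symGrading k V) where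
  one_mem := by simp [symGrading, Submodule.one_le.mp]
  mul_mem i j x y hx hy := by
    simp only [symGrading, pow_add] at *
    exact Submodule.mul_mem_mul hx hy

open scoped DirectSum in
/-- Auxiliary: the inclusion of `V` in degree one. -/
def symGradingι : V →ₗ[k] ⨁ i : ℕ, symGrading k V i :=
  DirectSum.lof k ℕ (fun i => symGrading k V i) 1 ∘ₗ
    (SymmetricAlgebra.ι k V).codRestrict (symGrading k V 1) (ι_mem_symGrading k V)

lemma symGradingι_apply (v : V) : symGradingι k V v =
    DirectSum.of (fun i : ℕ => symGrading k V i) 1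
      ⟨SymmetricAlgebra.ι k V v, ι_mem_symGrading k V v⟩ := rfl

instance symGrading_gradedAlgebra : GradedAlgebra (symGrading k V) :=
  GradedAlgebra.ofAlgHom _ (SymmetricAlgebra.lift (symGradingι k V))
    (by
      apply SymmetricAlgebra.algHom_ext
      ext v
      simp [symGradingι_apply])
    (by
      rintro i ⟨x, hx⟩
      dsimp only
      unfold symGrading at hx
      induction hx using Submodule.pow_induction_on_left' with
      | algebraMap r =>
        rw [AlgHom.commutes, DirectSum.algebraMap_apply]; rfl
      | add x y i hx hy ihx ihy =>
        rw [map_add, ihx, ihy, ← map_add]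
        rfl
      | mem_mul m hm i x hx ih =>
        obtain ⟨_, rfl⟩ := hm
        rw [map_mul, ih, SymmetricAlgebra.lift_ι_apply, symGradingι_apply, DirectSum.of_mul_of]
        exact DirectSum.of_eq_of_gradedMonoid_eq (Sigma.subtype_ext (add_comm _ _) rfl))

variable {k V}

/-- The algebra endomorphism `Sym f` of `Sym V` induced by an endomorphism `f` of `V`. -/
def symAlgMap (f : V →ₗ[k] V) : SymmetricAlgebra k V →ₐ[k] SymmetricAlgebra k V :=
  SymmetricAlgebra.lift (SymmetricAlgebra.ι k V ∘ₗ f)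

@[simp]
lemma symAlgMap_ι (f : V →ₗ[k] V) (v : V) :
    symAlgMap f (SymmetricAlgebra.ι k V v) = SymmetricAlgebra.ι k V (f v) := by
  simp [symAlgMap]

lemma symAlgMap_id : symAlgMap (LinearMap.id : V →ₗ[k] V) = AlgHom.id k _ := by
  apply SymmetricAlgebra.algHom_ext
  ext v
  simp

lemma symAlgMap_comp (f g : V →ₗ[k] V) :
    symAlgMap (f ∘ₗ g) = (symAlgMap f).comp (symAlgMap g) := by
  apply SymmetricAlgebra.algHom_ext
  ext v
  simp

lemma symAlgMap_mem (f : V →ₗ[k] V) {n : ℕ} {x : SymmetricAlgebra k V}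
    (hx : x ∈ symGrading k V n) : symAlgMap f x ∈ symGrading k V n := by
  have h : (symGrading k V n).map (symAlgMap f).toLinearMap ≤ symGrading k V n := by
    unfold symGrading
    rw [Submodule.map_pow]
    refine pow_le_pow_left' ?_ n
    rintro _ ⟨_, ⟨v, rfl⟩, rfl⟩
    exact ⟨f v, by simp⟩
  exact h ⟨x, hx, rfl⟩

/-- `Sym f` as a homomorphism of graded rings. -/
def symMap (f : V →ₗ[k] V) : GradedRingHom (symGrading k V) (symGrading k V) where
  toRingHom := (symAlgMap f).toRingHom
  map_mem hx := symAlgMap_mem f hx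

lemma symMap_mem (f : V →ₗ[k] V) {n : ℕ} {x : SymmetricAlgebra k V}
    (hx : x ∈ symGrading k V n) : symMap f x ∈ symGrading k V n := symAlgMap_mem f hx

lemma symMap_apply (f : V →ₗ[k] V) (x : SymmetricAlgebra k V) : symMap f x = symAlgMap f x := rfl

lemma symMap_id : symMap (LinearMap.id : V →ₗ[k] V) = GradedRingHom.id _ := by
  ext x
  simp [symMap_apply, symAlgMap_id]

lemma symMap_comp (f g : V →ₗ[k] V) : symMap (f ∘ₗ g) = (symMap f).comp (symMap g) := by
  ext x
  simp [symMap_apply, symAlgMap_comp]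

/-- A scalar `c` acts on `Symⁿ V` by `cⁿ`. -/
lemma symMap_scalar (c : k) {n : ℕ} {x : SymmetricAlgebra k V} (hx : x ∈ symGrading k V n) :
    symMap (c • (LinearMap.id : V →ₗ[k] V)) x = c ^ n • x := by
  rw [symMap_apply]
  unfold symGrading at hx
  induction hx using Submodule.pow_induction_on_left' with
  | algebraMap r => simp
  | add x y i hx hy ihx ihy => rw [map_add, ihx, ihy, smul_add]
  | mem_mul m hm i x hx ih =>
    obtain ⟨v, rfl⟩ := hm
    rw [map_mul, ih, symAlgMap_ι]
    simp [pow_succ', mul_smul, smul_comm c]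

end SymmetricAlgebra

/-! ### Group actions on schemes -/

/-- A right action of `G` on the `S`-scheme `p : X ⟶ S` by automorphisms over `S`. In the
diagrammatic order of composition, `act (g * h) = act g ≫ act h` says `x · (g h) = (x · g) · h`. -/
structure RightAction (G : Type u) [Group G] {S X : Scheme.{u}} (p : X ⟶ S) where
  act : G → (X ⟶ X)
  act_over : ∀ g, act g ≫ p = p
  act_one : act 1 = 𝟙 X
  act_mul : ∀ g h, act (g * h) = act g ≫ act h

namespace RightAction

variable {G H : Type u} [Group G] [Group H] {S X Y : Scheme.{u}} {p : X ⟶ S} {q : Y ⟶ S}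

instance isIso_act (α : RightAction G p) (g : G) : IsIso (α.act g) :=
  ⟨α.act g⁻¹, by rw [← α.act_mul, mul_inv_cancel, α.act_one],
    by rw [← α.act_mul, inv_mul_cancel, α.act_one]⟩

/-- The action of `H` obtained from an action of `G` and a homomorphism `H → G`. -/
def restrict (α : RightAction G p) (π : H →* G) : RightAction H p where
  act h := α.act (π h)
  act_over h := α.act_over _
  act_one := by rw [map_one, α.act_one]
  act_mul h h' := by rw [map_mul, α.act_mul]

lemma act_eq_of_ker (α : RightAction H p) (π : H →* G) (hker : ∀ z ∈ π.ker, α.act z = 𝟙 X)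
    {a b : H} (hab : π a = π b) : α.act a = α.act b := by
  have h : a * b⁻¹ ∈ π.ker := by simp [MonoidHom.mem_ker, hab]
  calc α.act a = α.act (a * b⁻¹ * b) := by simp
    _ = α.act b := by rw [α.act_mul, hker _ h, Category.id_comp]

/-- If `π : H → G` is surjective and its kernel acts trivially, an action of `H` induces an action
of `G`. -/
def descend (α : RightAction H p) (π : H →* G) (hπ : Function.Surjective π)
    (hker : ∀ z ∈ π.ker, α.act z = 𝟙 X) : RightAction G p where
  act g := α.act (Function.surjInv hπ g)
  act_over g := α.act_over _
  act_one := by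
    rw [← α.act_one]
    exact α.act_eq_of_ker π hker (by rw [Function.surjInv_eq hπ, map_one])
  act_mul g h := by
    rw [← α.act_mul]
    exact α.act_eq_of_ker π hker (by simp only [map_mul, Function.surjInv_eq hπ])

lemma descend_act (α : RightAction H p) (π : H →* G) (hπ : Function.Surjective π)
    (hker : ∀ z ∈ π.ker, α.act z = 𝟙 X) (h : H) :
    (α.descend π hπ hker).act (π h) = α.act h :=
  α.act_eq_of_ker π hker (Function.surjInv_eq hπ _)

end RightAction

/-! ### Dominant equivariant rational maps -/

/-- The partial map `f ∘ e`, for an isomorphism `e` and a partial map `f`. -/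
def precompIso {X' X Y : Scheme.{u}} (e : X' ⟶ X) [IsIso e] (f : X.PartialMap Y) :
    X'.PartialMap Y where
  domain := e ⁻¹ᵁ f.domain
  dense_domain := f.dense_domain.preimage e.homeomorph.isOpenMap
  hom := (e ∣_ f.domain) ≫ f.hom

/-- There is a dominant `G`-equivariant rational map `X ⤏ Y` over `S`. Rational maps are
represented by morphisms on dense open subschemes, and two of these define the same rational map
if they agree on some dense open subscheme. -/
def ExistsDominantEquivariantMap {G : Type u} [Group G] {S X Y : Scheme.{u}}
    {p : X ⟶ S} {q : Y ⟶ S} (α : RightAction G p) (β : RightAction G q) : Prop :=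
  ∃ f : X.PartialMap Y, f.hom ≫ q = f.domain.ι ≫ p ∧ IsDominant f.hom ∧
    ∀ g : G, (precompIso (α.act g) f).toRationalMap = (f.compHom (β.act g)).toRationalMap

/-! ### The projective space of a representation -/

section ProjectiveSpace

variable (k V : Type u) [Field k] [AddCommGroup V] [Module k V]

/-- `ℙ(V^∨) = Proj (Sym V)`, the projective space of lines in the dual `V^∨`. -/
abbrev projSpace : Scheme.{u} := Proj (symGrading k V)

/-- The structure morphism `ℙ(V^∨) ⟶ Spec k`. -/
def projSpaceStr : projSpace k V ⟶ Spec (.of k) :=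
  Proj.toSpecZero (symGrading k V) ≫
    Spec.map (CommRingCat.ofHom (algebraMap k (symGrading k V 0)))

variable {k V}

lemma irrelevant_le_map_symMap (f g : V →ₗ[k] V) (h : f ∘ₗ g = LinearMap.id) :
    HomogeneousIdeal.irrelevant (symGrading k V) ≤
      (HomogeneousIdeal.irrelevant (symGrading k V)).map (symMap f) := by
  rw [HomogeneousIdeal.irrelevant_le]
  intro i hi x hx
  have hx' : symMap f (symMap g x) = x := by
    have := congrArg (fun F => F x) (symMap_comp f g)
    simpa [h, symMap_id] using this.symm
  rw [← hx']
  exact Ideal.mem_map_of_mem (symMap f)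
    (HomogeneousIdeal.mem_irrelevant_of_mem _ hi (symAlgMap_mem g hx))

lemma projSpace_hom_ext (f : V →ₗ[k] V)
    (hf : HomogeneousIdeal.irrelevant (symGrading k V) ≤
      (HomogeneousIdeal.irrelevant (symGrading k V)).map (symMap f))
    {Y : Scheme.{u}} (a b : projSpace k V ⟶ Y)
    (h : ∀ (i : ℕ) (hi : 0 < i) (s : SymmetricAlgebra k V) (hs : s ∈ symGrading k V i),
      Proj.awayι (symGrading k V) (symMap f s) (symMap_mem f hs) hi ≫ a =
        Proj.awayι (symGrading k V) (symMap f s) (symMap_mem f hs) hi ≫ b) : a = b :=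
  (Proj.mapAffineOpenCover (symMap f) hf).openCover.hom_ext _ _
    fun s ↦ h s.1 s.1.2 s.2 s.2.2

lemma projMap_comp_str (f : V →ₗ[k] V)
    (hf : HomogeneousIdeal.irrelevant (symGrading k V) ≤
      (HomogeneousIdeal.irrelevant (symGrading k V)).map (symMap f)) :
    Proj.map (symMap f) hf ≫ projSpaceStr k V = projSpaceStr k V := by
  refine projSpace_hom_ext f hf _ _ fun i hi s hs ↦ ?_
  rw [projSpaceStr, Proj.awayι_comp_map_assoc _ _ hi _ hs, Proj.awayι_toSpecZero_assoc,
    Proj.awayι_toSpecZero_assoc]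
  simp only [← Spec.map_comp, ← CommRingCat.ofHom_comp]
  congr 2
  refine RingHom.ext fun a ↦ ?_
  refine HomogeneousLocalization.val_injective _ ?_
  change Localization.mk (symAlgMap f (algebraMap k (SymmetricAlgebra k V) a))
      ⟨symAlgMap f 1, _⟩ = Localization.mk (algebraMap k (SymmetricAlgebra k V) a) ⟨1, _⟩
  congr 1
  · exact AlgHom.commutes _ _
  · exact Subtype.ext (map_one _)

lemma awayMap_scalar (c : k) {i : ℕ} {s g : SymmetricAlgebra k V} (hs : s ∈ symGrading k V i)
    (hg : g ∈ symGrading k V 0) (hgc : g = algebraMap k _ (c ^ i))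
    (hx : symMap (c • (LinearMap.id : V →ₗ[k] V)) s = s * g) :
    HomogeneousLocalization.Away.map (symMap (c • (LinearMap.id : V →ₗ[k] V))) s =
      HomogeneousLocalization.awayMap (symGrading k V) hg hx := by
  ext a
  obtain ⟨n, x, hx', rfl⟩ := a.mk_surjective _ hs
  rw [HomogeneousLocalization.Away.map_mk, HomogeneousLocalization.awayMap_mk]
  simp only [HomogeneousLocalization.Away.val_mk, symMap_scalar c hx', hgc]
  congr 1
  rw [Algebra.smul_def, mul_comm, ← map_pow, ← pow_mul, smul_eq_mul, mul_comm n]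

lemma projMap_scalar (c : k)
    (hf : HomogeneousIdeal.irrelevant (symGrading k V) ≤
      (HomogeneousIdeal.irrelevant (symGrading k V)).map (symMap (c • LinearMap.id))) :
    Proj.map (symMap (c • (LinearMap.id : V →ₗ[k] V))) hf = 𝟙 (projSpace k V) := by
  refine projSpace_hom_ext _ hf _ _ fun i hi s hs ↦ ?_
  rw [Proj.awayι_comp_map _ _ hi _ hs]
  have hg : algebraMap k (SymmetricAlgebra k V) (c ^ i) ∈ symGrading k V 0 := by
    rw [symGrading, pow_zero, Submodule.mem_one]
    exact ⟨_, rfl⟩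
  have hx : symMap (c • (LinearMap.id : V →ₗ[k] V)) s =
      s * algebraMap k (SymmetricAlgebra k V) (c ^ i) := by
    rw [symMap_scalar c hs, Algebra.smul_def, mul_comm]
  rw [awayMap_scalar c hs hg rfl hx, Category.comp_id]
  exact Proj.SpecMap_awayMap_awayι _ hs hi hg hx

/-- The right action of `G` on `ℙ(V^∨)` induced by a (left) representation of `G` on `V`. -/
def projAction {G : Type u} [Group G] (ρ : Representation k G V) :
    RightAction G (projSpaceStr k V) where
  act g := Proj.map (symMap (ρ g)) (irrelevant_le_map_symMap (ρ g) (ρ g⁻¹)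
    (by rw [← Module.End.mul_eq_comp, ← map_mul, mul_inv_cancel, map_one]; rfl))
  act_over g := projMap_comp_str _ _
  act_one := by
    have h : symMap (ρ 1) = GradedRingHom.id (symGrading k V) := by
      rw [map_one]; exact symMap_id
    simp only [h]
    exact Proj.map_id
  act_mul g h := by
    have e : symMap (ρ (g * h)) = (symMap (ρ g)).comp (symMap (ρ h)) := by
      rw [map_mul]; exact symMap_comp _ _
    simp only [e]
    exact Proj.map_comp _ _ _ _

lemma projAction_act_scalar {G : Type u} [Group G] (ρ : Representation k G V) (g : G) (c : k)
    (h : ∀ v, ρ g v = c • v) : (projAction ρ).act g = 𝟙 _ := by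
  have e : ρ g = c • (LinearMap.id : V →ₗ[k] V) := by ext v; simp [h]
  simp only [projAction, e]
  exact projMap_scalar c _

end ProjectiveSpace

/-- `p : X ⟶ Spec k` is projective: `X` is a closed subscheme of some `ℙⁿ` over `k`. -/
def IsProjectiveOver {k : Type u} [Field k] {X : Scheme.{u}} (p : X ⟶ Spec (.of k)) : Prop :=
  ∃ (n : ℕ) (i : X ⟶ projSpace k (Fin (n + 1) → k)),
    IsClosedImmersion i ∧ i ≫ projSpaceStr k (Fin (n + 1) → k) = p

/-- The action `α` of `G` is unirational: there is a (finite-dimensional) representation `V` of `G`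
and a dominant `G`-equivariant rational map `ℙ(V^∨) ⤏ X`. -/
def IsUnirational {k : Type u} [Field k] {G : Type u} [Group G] {X : Scheme.{u}}
    {p : X ⟶ Spec (.of k)} (α : RightAction G p) : Prop :=
  ∃ (V : Type u) (_ : AddCommGroup V) (_ : Module k V) (_ : FiniteDimensional k V)
    (ρ : Representation k G V), ExistsDominantEquivariantMap (projAction ρ) α

/-! ### Central cyclic extensions and their classes -/

/-- A central cyclic extension `1 → Z → Ĝ → G → 1` of a finite group `G`, where `Z = ker π`,
together with an identification `χ` of `Z` with a group `⟨ζ⟩` of roots of unity in `k`. (An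
injective `χ : Z →* kˣ` is the same as an isomorphism of `Z` with `⟨ζ⟩`, for `ζ` a primitive root
of unity of order `|Z|`.) -/
structure CentralCyclicExtension (k G : Type u) [Field k] [Group G] where
  /-- the group `Ĝ` -/
  carrier : Type u
  [group : Group carrier]
  [finite : Finite carrier]
  /-- the projection `Ĝ → G` -/
  π : carrier →* G
  π_surjective : Function.Surjective π
  central : π.ker ≤ Subgroup.center carrier
  cyclic : IsCyclic π.ker
  /-- the identification of the kernel with roots of unity -/
  χ : π.ker →* kˣ
  χ_injective : Function.Injective χ

attribute [instance] CentralCyclicExtension.group CentralCyclicExtension.finite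

/-- `kˣ` as a `G`-module with trivial action. -/
abbrev unitsRep (k G : Type u) [Field k] [Group G] : Rep (ULift.{u} ℤ) G :=
  Rep.trivial (ULift.{u} ℤ) G (Additive kˣ)

namespace CentralCyclicExtension

variable {k G : Type u} [Field k] [Group G] (E : CentralCyclicExtension k G)

/-- A set-theoretic section of `Ĝ → G`. -/
def sec : G → E.carrier := Function.surjInv E.π_surjective

lemma π_sec (g : G) : E.π (E.sec g) = g := Function.surjInv_eq E.π_surjective g

/-- The element `s(g) s(h) s(gh)⁻¹` of the kernel, for the section `s`. -/
def factor (g h : G) : E.π.ker :=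
  ⟨E.sec g * E.sec h * (E.sec (g * h))⁻¹, by simp [MonoidHom.mem_ker, π_sec]⟩

lemma factor_mul (g h j : G) :
    E.factor (g * h) j * E.factor g h = E.factor h j * E.factor g (h * j) := by
  have hc : ∀ (z : E.π.ker) (x : E.carrier), x * z = z * x := fun z x =>
    Subgroup.mem_center_iff.mp (E.central z.2) x
  have hf : ∀ a b : G, E.sec a * E.sec b = E.factor a b * E.sec (a * b) := by
    intro a b; simp [factor]
  apply Subtype.ext
  apply mul_right_cancel (b := E.sec (g * h * j))
  simp only [Subgroup.coe_mul]
  calc (E.factor (g * h) j : E.carrier) * E.factor g h * E.sec (g * h * j)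
      = E.factor g h * (E.factor (g * h) j * E.sec (g * h * j)) := by
        rw [hc (E.factor g h), mul_assoc]
    _ = E.sec g * (E.sec h * E.sec j) := by
        rw [← hf (g * h) j, ← mul_assoc, ← hf g h, mul_assoc]
    _ = E.factor h j * (E.sec g * E.sec (h * j)) := by
        rw [hf h j, ← mul_assoc, hc, mul_assoc]
    _ = E.factor h j * E.factor g (h * j) * E.sec (g * h * j) := by
        rw [hf g (h * j), mul_assoc g h j, mul_assoc]

/-- The factor set `(g, h) ↦ χ(s(g) s(h) s(gh)⁻¹)` with values in `kˣ`. -/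
def factorSet (x : G × G) : Additive kˣ := Additive.ofMul (E.χ (E.factor x.1 x.2))

lemma factorSet_add (g h j : G) : E.factorSet (g * h, j) + E.factorSet (g, h) =
    E.factorSet (h, j) + E.factorSet (g, h * j) := by
  simp only [factorSet, ← ofMul_mul, ← map_mul, factor_mul]

/-- The factor set as a 2-cocycle. -/
def cocycle : groupCohomology.cocycles₂ (unitsRep k G) :=
  ⟨E.factorSet, (groupCohomology.mem_cocycles₂_iff (A := unitsRep k G) E.factorSet).mpr
    E.factorSet_add⟩

/-- The class of the extension in `H²(G, kˣ)`. -/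
def cls : groupCohomology.H2 (unitsRep k G) :=
  groupCohomology.H2π (unitsRep k G) E.cocycle

/-- `Z` acts on the representation `ρ` of `Ĝ` by scalars, through its identification with roots of
unity. -/
def KernelActsByScalars {V : Type u} [AddCommGroup V] [Module k V]
    (ρ : Representation k E.carrier V) : Prop :=
  ∀ (z : E.π.ker) (v : V), ρ z v = (E.χ z : k) • v

/-- The action of `G = Ĝ / Z` on `ℙ(V^∨)`, for a representation `V` of `Ĝ` on which `Z` acts by
scalars. -/
def quotientProjAction {V : Type u} [AddCommGroup V] [Module k V]
    (ρ : Representation k E.carrier V) (h : E.KernelActsByScalars ρ) :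
    RightAction G (projSpaceStr k V) :=
  (projAction ρ).descend E.π E.π_surjective
    fun z hz => projAction_act_scalar ρ z _ (h ⟨z, hz⟩)

/-- The representation `W^{⊕ m}`. -/
abbrev copies {W : Type u} [AddCommGroup W] [Module k W] (ρ : Representation k E.carrier W)
    (m : ℕ) : Representation k E.carrier (DirectSum (Fin m) fun _ => W) :=
  Representation.directSum fun _ => ρ

lemma KernelActsByScalars.copies {W : Type u} [AddCommGroup W] [Module k W]
    {ρ : Representation k E.carrier W} (h : E.KernelActsByScalars ρ) (m : ℕ) :
    E.KernelActsByScalars (E.copies ρ m) := by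
  intro z v
  ext i
  simp [Representation.directSum, h z, DirectSum.smul_apply]

end CentralCyclicExtension

end

end EquivUnirational

namespace EquivUnirational

noncomputable section

/-! ### A point of the dual representation with trivial projective stabilizers -/

section GenericPoint

variable {k H W : Type u} [Field k] [CharZero k] [Group H] [Finite H]
  [AddCommGroup W] [Module k W] [FiniteDimensional k W] [Nontrivial W]

/-! From (ii) to (i), `E` itself serves, with V = W^m, since the action of G on the projective space
is induced by that of the extension.

From (i) to (ii), let V be a representation of an extension `E'` of class γ whose projective space
dominates X. Equality of classes turns W into a representation of `E'` that is projectively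
unchanged (`exists_rep_of_cls_eq`). Let H be the group of `E'`, Z its kernel, N = |Z|, n = dim V and
U = W^(n+1). Now Z acts on W by a faithful character and trivially on X, and no element outside Z
acts on W by a scalar.

Such a W has a point x of its dual that no element outside Z fixes up to scalar
(`exists_dual_not_proportional`). The map ξ ↦ (x, ξ(b₁)x, …, ξ(bₙ)x) from V^∨ to U^∨, for a basis b
of V, is not equivariant, but interpolation on the orbit of x and a sum over H give an equivariant
polynomial map U^∨ → V^∨ of which it is a section (`exists_equivariant_section`). On rings: an
equivariant φ : Sym V → Sym U with a retraction ev.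

This φ does not respect degrees. However, the function field of X consists of Z-invariants in
k(V^∨), and φ sends invariant polynomials to polynomials whose degrees are all divisible by N. The
same interpolation yields H-invariant forms q₁, q₂ of degrees d + N and d with ev q₁ = ev q₂ = 1
(`exists_invariant_of_card_dvd`). If s^N = q₂/q₁, then s has degree -1, and the substitution u ↦ su
makes these images homogeneous of degree zero without losing equivariance (`exists_homogenization`).
Since ev still recovers the original polynomial, nothing nonzero is killed
(`exists_embedding_of_section`). So k(X) embeds equivariantly in the rational functions on the
projective space of U.

The translation between such embeddings and dominant equivariant rational maps is made at generic
points (`exists_functionField_embedding`, `existsDominantEquivariantMap_of_embedding`). -/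

lemma exists_dual_not_proportional (ρ : Representation k H W) (Z : Set H)
    (hZ : ∀ g : H, (∃ c : k, ∀ w, ρ g w = c • w) → g ∈ Z) :
    ∃ x : Module.Dual k W, x ≠ 0 ∧ ∀ g ∉ Z, ∀ c : k, x ∘ₗ ρ g ≠ c • x := by
  classical
  have : Infinite k := Infinite.of_injective _ (Nat.cast_injective (R := k))
  have : Fintype H := Fintype.ofFinite H
  let D : H → Module.End k (Module.Dual k W) := fun g => Module.Dual.transpose (ρ g)
  -- A vector space over an infinite field is not a finite union of proper subspaces. The ones to
  -- avoid are the eigenspaces of the transposes of the elements outside `Z`, proper because these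
  -- elements are not scalar; `⊥` is added to force `x ≠ 0`.
  let s : Finset (Subspace k (Module.Dual k W)) :=
    insert ⊥ ((Finset.univ.filter (· ∉ Z)).biUnion fun g =>
      (Module.End.finite_hasEigenvalue (D g)).toFinset.image fun c => (D g).eigenspace c)
  have hs : ⊤ ∉ s := by
    intro h
    simp only [s, Finset.mem_insert, Finset.mem_biUnion, Finset.mem_filter, Finset.mem_univ,
      true_and, Finset.mem_image, Set.Finite.mem_toFinset, Set.mem_ofPred_eq] at h
    rcases h with h | ⟨g, hg, c, -, h⟩
    · exact top_ne_bot h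
    · refine hg (hZ g ⟨c, fun w => ?_⟩)
      rw [← sub_eq_zero, ← Module.forall_dual_apply_eq_zero_iff k]
      intro x
      have hx : x ∈ (D g).eigenspace c := h ▸ Submodule.mem_top
      have := congrArg (fun y : Module.Dual k W => y w) (Module.End.mem_eigenspace_iff.mp hx)
      simpa [D, sub_eq_zero, Module.Dual.transpose_apply] using this
  obtain ⟨x, hx⟩ := (Set.ne_univ_iff_exists_notMem _).mp
    (Subspace.biUnion_ne_univ_of_top_notMem hs)
  simp only [Set.mem_iUnion, not_exists] at hx
  have hx0 : x ≠ 0 := by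
    rintro rfl
    exact hx ⊥ (Finset.mem_insert_self _ _) (zero_mem _)
  refine ⟨x, hx0, fun g hg c h => ?_⟩
  have hmem : x ∈ (D g).eigenspace c := Module.End.mem_eigenspace_iff.mpr h
  refine hx _ (Finset.mem_insert_of_mem (Finset.mem_biUnion.mpr ⟨g, by simpa using hg,
    Finset.mem_image.mpr ⟨c, ?_, rfl⟩⟩)) hmem
  simpa using Module.End.hasEigenvalue_of_hasEigenvector ⟨hmem, hx0⟩

end GenericPoint

/-- Otherwise the kernel of `y` lies in that of `x`, which makes `x` a multiple of `y`. -/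
lemma exists_apply_eq_one_of_not_proportional {k W : Type u} [Field k] [AddCommGroup W]
    [Module k W] {x y : Module.Dual k W}
    (h : ∀ c : k, x ≠ c • y) : ∃ w, x w = 1 ∧ y w = 0 := by
  have : ¬ LinearMap.ker y ≤ LinearMap.ker x := by
    intro hle
    have := mem_span_of_iInf_ker_le_ker (ι := Unit) (L := fun _ => y) (K := x) (by simpa using hle)
    rw [Set.range_const, Submodule.mem_span_singleton] at this
    obtain ⟨c, hc⟩ := this
    exact h c hc.symm
  obtain ⟨w, hw, hw'⟩ := SetLike.not_le_iff_exists.mp this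
  rw [LinearMap.mem_ker] at hw hw'
  exact ⟨(x w)⁻¹ • w, by simp [hw'], by simp [hw]⟩

/-! ### The action on the symmetric algebra and on its fraction field -/

section SymFrac

variable {k H V : Type u} [Field k] [Group H] [AddCommGroup V] [Module k V]
  (ρ : Representation k H V)

lemma symAlgMap_rep_mul (g h : H) (x : SymmetricAlgebra k V) :
    symAlgMap (ρ (g * h)) x = symAlgMap (ρ g) (symAlgMap (ρ h) x) := by
  rw [map_mul, Module.End.mul_eq_comp, symAlgMap_comp]; rfl

lemma symAlgMap_rep_one (x : SymmetricAlgebra k V) : symAlgMap (ρ 1) x = x := by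
  rw [map_one, Module.End.one_eq_id, symAlgMap_id]; rfl

lemma symAlgMap_rep_injective (g : H) : Function.Injective (symAlgMap (ρ g)) := by
  refine Function.LeftInverse.injective (g := symAlgMap (ρ g⁻¹)) fun x => ?_
  rw [← symAlgMap_rep_mul, inv_mul_cancel, symAlgMap_rep_one]

variable (k V) in
/-- The field of rational functions on the affine space `V^∨`. -/
abbrev SymFrac : Type u := FractionRing (SymmetricAlgebra k V)

/-- The action of a group element on the field of rational functions. -/
def symFracMap (g : H) : SymFrac k V →+* SymFrac k V :=
  IsFractionRing.lift (A := SymmetricAlgebra k V)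
    (g := (algebraMap (SymmetricAlgebra k V) (SymFrac k V)).comp
      (symAlgMap (ρ g) : SymmetricAlgebra k V →+* SymmetricAlgebra k V))
    ((IsFractionRing.injective _ _).comp (symAlgMap_rep_injective ρ g))

@[simp]
lemma symFracMap_algebraMap (g : H) (x : SymmetricAlgebra k V) :
    symFracMap ρ g (algebraMap _ _ x) = algebraMap _ _ (symAlgMap (ρ g) x) :=
  IsFractionRing.lift_algebraMap _ x

variable (k V) in
/-- The rational functions on `V^∨` that are homogeneous of degree zero, that is, the rational
functions on `ℙ(V^∨)`. -/
def IsDegreeZero (y : SymFrac k V) : Prop :=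
  ∃ (n : ℕ) (a b : SymmetricAlgebra k V), a ∈ symGrading k V n ∧ b ∈ symGrading k V n ∧ b ≠ 0 ∧
    y = algebraMap _ _ a / algebraMap _ _ b

/-- The substitution `v ↦ s v`, with values in an extension field. -/
def scaleHom {F : Type u} [Field F] [Algebra (SymmetricAlgebra k V) F] [Algebra k F]
    [IsScalarTower k (SymmetricAlgebra k V) F] (s : F) : SymmetricAlgebra k V →ₐ[k] F :=
  SymmetricAlgebra.lift (LinearMap.mulLeft k s ∘ₗ
    (IsScalarTower.toAlgHom k (SymmetricAlgebra k V) F).toLinearMap ∘ₗ SymmetricAlgebra.ι k V)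

lemma scaleHom_of_mem {F : Type u} [Field F] [Algebra (SymmetricAlgebra k V) F] [Algebra k F]
    [IsScalarTower k (SymmetricAlgebra k V) F] (s : F) {n : ℕ} {x : SymmetricAlgebra k V}
    (hx : x ∈ symGrading k V n) : scaleHom s x = s ^ n * algebraMap _ F x := by
  unfold symGrading at hx
  induction hx using Submodule.pow_induction_on_left' with
  | algebraMap r =>
    rw [AlgHom.commutes, pow_zero, one_mul, ← IsScalarTower.algebraMap_apply]
  | add x y i hx hy ihx ihy => rw [map_add, ihx, ihy, map_add, mul_add]
  | mem_mul m hm i x hx ih =>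
    obtain ⟨v, rfl⟩ := hm
    rw [map_mul, ih, map_mul, scaleHom, SymmetricAlgebra.lift_ι_apply]
    simp only [LinearMap.coe_comp, Function.comp_apply, LinearMap.mulLeft_apply,
      AlgHom.toLinearMap_apply, IsScalarTower.coe_toAlgHom', Nat.succ_eq_add_one]
    ring

end SymFrac

/-! ### Twisted homogenization of invariants -/

section Homogenize

variable {k H U : Type u} [Field k] [Group H] [AddCommGroup U] [Module k U]
  (ρ : Representation k H U)

/-- If a subgroup of order `N` acts on `U` through a faithful character, an element of `Sym U`
invariant under it only has components of degree divisible by `N`. -/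
lemma card_dvd_of_component_ne_zero {Z : Subgroup H} [Finite Z] [IsCyclic Z] (χ : Z →* kˣ)
    (hχ : Function.Injective χ) (hZ : ∀ (z : Z) (v : U), ρ z v = (χ z : k) • v)
    {P : SymmetricAlgebra k U} (hP : ∀ z : Z, symAlgMap (ρ z) P = P) {n : ℕ}
    (hn : (DirectSum.decompose (symGrading k U) P n : SymmetricAlgebra k U) ≠ 0) :
    Nat.card Z ∣ n := by
  classical
  obtain ⟨z, hz⟩ := IsCyclic.exists_generator (α := Z)
  rw [← orderOf_eq_card_of_forall_mem_zpowers hz]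
  refine orderOf_dvd_of_pow_eq_one (hχ ?_)
  rw [map_one, map_pow, Units.ext_iff]
  set c : k := (χ z : k)
  have e : ρ z = c • LinearMap.id := by ext v; simp [hZ z v, c]
  -- The generator `z` multiplies the degree `m` component by `c ^ m`, and `c` has order `|Z|`.
  -- Comparing degree `n` components of `z P = P` gives `c ^ n = 1`.
  have hcomp : ∀ m : ℕ, symAlgMap (ρ z) (DirectSum.decompose (symGrading k U) P m) =
      c ^ m • (DirectSum.decompose (symGrading k U) P m : SymmetricAlgebra k U) := by
    intro m
    rw [e, ← symMap_apply]
    exact symMap_scalar c (SetLike.coe_mem _)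
  have hd := congrArg (fun x => (DirectSum.decompose (symGrading k U) x n :
    SymmetricAlgebra k U)) (hP z)
  have hdec : symAlgMap (ρ z) P = ∑ m ∈ (DirectSum.decompose (symGrading k U) P).support,
      c ^ m • (DirectSum.decompose (symGrading k U) P m : SymmetricAlgebra k U) := by
    conv_lhs => rw [← DirectSum.sum_support_decompose (symGrading k U) P, map_sum]
    exact Finset.sum_congr rfl fun m _ => hcomp m
  have key : (DirectSum.decompose (symGrading k U) (symAlgMap (ρ z) P) n :
      SymmetricAlgebra k U) =
      c ^ n • (DirectSum.decompose (symGrading k U) P n : SymmetricAlgebra k U) := by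
    rw [← GradedRing.proj_apply, hdec, map_sum]
    simp only [GradedRing.proj_apply]
    rw [Finset.sum_eq_single n]
    · rw [DirectSum.decompose_of_mem_same]
      exact Submodule.smul_mem _ _ (SetLike.coe_mem _)
    · intro m _ hm
      exact DirectSum.decompose_of_mem_ne _ (Submodule.smul_mem _ _ (SetLike.coe_mem _)) hm
    · intro hn'
      exact absurd (by simpa using hn') hn
  rw [key] at hd
  have := sub_eq_zero.mpr (hd.trans (one_smul k _).symm)
  rw [← sub_smul, smul_eq_zero, sub_eq_zero] at this
  simpa using this.resolve_right hn

/-- Given invariants `q₁`, `q₂` of degrees `d + N`, `d` and `s` with `s ^ N q₁ = q₂`, the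
substitution `u ↦ s u` turns an element of `Sym U` whose components have degree divisible by `N`
into a rational function of degree zero. -/
lemma exists_homogenization {B : Type u} [CommRing B] (ev : SymmetricAlgebra k U →+* B)
    {F : Type u} [Field F] [Algebra (SymmetricAlgebra k U) F] [Algebra k F]
    [IsScalarTower k (SymmetricAlgebra k U) F] {d N : ℕ} {q₁ q₂ : SymmetricAlgebra k U}
    (h₁ : q₁ ∈ symGrading k U (d + N)) (h₂ : q₂ ∈ symGrading k U d)
    (i₁ : ∀ h, symAlgMap (ρ h) q₁ = q₁) (i₂ : ∀ h, symAlgMap (ρ h) q₂ = q₂)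
    (e₁ : ev q₁ = 1) (e₂ : ev q₂ = 1) {s : F}
    (hs : s ^ N * algebraMap _ F q₁ = algebraMap _ F q₂) {P : SymmetricAlgebra k U}
    (hP : ∀ n, (DirectSum.decompose (symGrading k U) P n : SymmetricAlgebra k U) ≠ 0 → N ∣ n) :
    ∃ (R : ℕ) (A : SymmetricAlgebra k U), A ∈ symGrading k U (R * (d + N)) ∧ ev A = ev P ∧
      ∀ h, scaleHom s (symAlgMap (ρ h) P) * algebraMap _ F q₁ ^ R =
        algebraMap _ F (symAlgMap (ρ h) A) := by
  classical
  set I := (DirectSum.decompose (symGrading k U) P).support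
  set p : ℕ → SymmetricAlgebra k U := fun n => DirectSum.decompose (symGrading k U) P n
  have hsum : P = ∑ n ∈ I, p n := (DirectSum.sum_support_decompose _ P).symm
  have hmem : ∀ n, p n ∈ symGrading k U n := fun n => SetLike.coe_mem _
  have hex : ∃ r : ℕ → ℕ, ∀ n ∈ I, n = N * r n := by
    have : ∀ n, ∃ r, n ∈ I → n = N * r := by
      intro n
      by_cases hn : n ∈ I
      · obtain ⟨r, hr⟩ := hP n (by simpa [I] using hn)
        exact ⟨r, fun _ => hr⟩
      · exact ⟨0, fun h => absurd h hn⟩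
    choose r hr using this
    exact ⟨r, hr⟩
  obtain ⟨r, hr⟩ := hex
  let R := I.sup r
  have hR : ∀ n ∈ I, r n ≤ R := fun n hn => Finset.le_sup hn
  -- The substitution multiplies `p n` by `s ^ n = (q₂ / q₁) ^ r n`; the factor `q₁ ^ R` clears all
  -- denominators at once. Each summand has degree `(R - r n)(d + N) + r n * d + N * r n = R (d +
  -- N)`.
  refine ⟨R, ∑ n ∈ I, q₁ ^ (R - r n) * q₂ ^ r n * p n, ?_, ?_, ?_⟩
  · refine sum_mem fun n hn => ?_
    have := SetLike.mul_mem_graded (SetLike.mul_mem_graded (SetLike.pow_mem_graded (R - r n) h₁)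
      (SetLike.pow_mem_graded (r n) h₂)) (hmem n)
    convert this using 2
    obtain ⟨t, ht⟩ := Nat.exists_eq_add_of_le (hR n hn)
    have hn' := hr n hn
    simp only [smul_eq_mul]
    rw [ht, Nat.add_sub_cancel_left]
    conv_rhs => rw [hn']
    have : r (N * r n) = r n := by rw [← hn']
    rw [this]
    ring
  · rw [map_sum]
    conv_rhs => rw [hsum, map_sum]
    refine Finset.sum_congr rfl fun n _ => ?_
    simp [e₁, e₂]
  · intro h
    conv_lhs => rw [hsum]
    rw [map_sum, map_sum, map_sum, map_sum, Finset.sum_mul]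
    refine Finset.sum_congr rfl fun n hn => ?_
    rw [scaleHom_of_mem s (symAlgMap_mem (ρ h) (hmem n))]
    simp only [map_mul, map_pow, i₁, i₂]
    rw [← hs]
    obtain ⟨t, ht⟩ := Nat.exists_eq_add_of_le (hR n hn)
    have hsn : s ^ n = (s ^ N) ^ r n := by rw [← pow_mul, ← hr n hn]
    rw [hsn, ht, Nat.add_sub_cancel_left]
    ring

end Homogenize

end

end EquivUnirational

namespace EquivUnirational

noncomputable section

/-! ### Interpolation at a point with trivial stabilizers -/

section Interpolation

variable {k H W U B : Type u} [Field k] [Group H] [Finite H]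
  [AddCommGroup W] [Module k W] [AddCommGroup U] [Module k U] [CommRing B] [Algebra k B]
  {ρ : Representation k H W} {σ : Representation k H U} {j : W →ₗ[k] U}
  {ev : SymmetricAlgebra k U →ₐ[k] B} {x : Module.Dual k W}

/-- A product over `h ≠ 1` of affine functions on `W^∨` equal to one at `x` and zero at `x ∘ ρ h`.
It isolates the term `h = 1` in a sum over the group. -/
lemma exists_interpolation (hj : ∀ h w, σ h (j w) = j (ρ h w))
    (hev : ∀ w, ev (SymmetricAlgebra.ι k U (j w)) = algebraMap k B (x w))
    (hx : ∀ h ≠ 1, x ∘ₗ ρ h ≠ x) :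
    ∃ e : SymmetricAlgebra k U, ev e = 1 ∧ ∀ h ≠ 1, ev (symAlgMap (σ h) e) = 0 := by
  classical
  have : Fintype H := Fintype.ofFinite H
  have hw : ∀ h : H, ∃ (w : W) (c : k), h ≠ 1 → x w + c = 1 ∧ x (ρ h w) + c = 0 := by
    intro h
    by_cases hh : h = 1
    · exact ⟨0, 0, fun h => absurd hh h⟩
    · obtain ⟨w, hw⟩ : ∃ w, x (ρ h w) ≠ x w := by
        by_contra! hcon
        exact hx h hh (LinearMap.ext hcon)
      have h0 : x w - x (ρ h w) ≠ 0 := sub_ne_zero.mpr hw.symm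
      refine ⟨(x w - x (ρ h w))⁻¹ • w, -((x w - x (ρ h w))⁻¹ * x (ρ h w)), fun _ => ⟨?_, ?_⟩⟩
      · simp only [map_smul, smul_eq_mul]
        rw [← sub_eq_add_neg, ← mul_sub, inv_mul_cancel₀ h0]
      · simp
  choose w c hwc using hw
  refine ⟨∏ h ∈ Finset.univ.erase (1 : H),
    (SymmetricAlgebra.ι k U (j (w h)) + algebraMap k _ (c h)), ?_, fun h hh => ?_⟩
  · rw [map_prod]
    refine Finset.prod_eq_one fun h hh => ?_
    rw [map_add, hev, AlgHom.commutes, ← map_add, (hwc h (Finset.ne_of_mem_erase hh)).1, map_one]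
  · rw [map_prod, map_prod]
    refine Finset.prod_eq_zero (i := h) (by simpa using hh) ?_
    rw [map_add, symAlgMap_ι, hj, map_add, hev, AlgHom.commutes, AlgHom.commutes, ← map_add,
      (hwc h hh).2, map_zero]

/-- With linear forms as factors, `x` can be separated only from translates that are not
proportional to it, hence the restriction to `h ∉ Z`. Powers of a form with value one at `x` fill up
the degree. -/
lemma exists_homogeneous_interpolation (hj : ∀ h w, σ h (j w) = j (ρ h w))
    (hev : ∀ w, ev (SymmetricAlgebra.ι k U (j w)) = algebraMap k B (x w)) (hx0 : x ≠ 0)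
    (Z : Set H) (hx : ∀ h ∉ Z, ∀ c : k, x ∘ₗ ρ h ≠ c • x) :
    ∃ r : ℕ, ∀ d ≥ r, ∃ e ∈ symGrading k U d, ev e = 1 ∧ ∀ h ∉ Z, ev (symAlgMap (σ h) e) = 0 := by
  classical
  have : Fintype H := Fintype.ofFinite H
  obtain ⟨w₁, hw₁⟩ : ∃ w, x w = 1 := by
    obtain ⟨w, hw⟩ : ∃ w, x w ≠ 0 := by
      by_contra! hcon
      exact hx0 (LinearMap.ext hcon)
    exact ⟨(x w)⁻¹ • w, by simp [hw]⟩
  have hw : ∀ h : H, ∃ w : W, h ∉ Z → x w = 1 ∧ x (ρ h w) = 0 := by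
    intro h
    by_cases hh : h ∈ Z
    · exact ⟨0, fun h => absurd hh h⟩
    · obtain ⟨w, hw⟩ := exists_apply_eq_one_of_not_proportional (x := x) (y := x ∘ₗ ρ h) <| by
        intro c hc
        have hc0 : c ≠ 0 := by
          rintro rfl
          exact hx0 (by simpa using hc)
        refine hx h hh c⁻¹ ?_
        conv_rhs => rw [hc]
        rw [smul_smul, inv_mul_cancel₀ hc0, one_smul]
      exact ⟨w, fun _ => hw⟩
  choose w hwx using hw
  let J : Finset H := Finset.univ.filter (· ∉ Z)
  refine ⟨J.card, fun d hd => ⟨(∏ h ∈ J, SymmetricAlgebra.ι k U (j (w h))) *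
    SymmetricAlgebra.ι k U (j w₁) ^ (d - J.card), ?_, ?_, fun h hh => ?_⟩⟩
  · have h₁ : (∏ h ∈ J, SymmetricAlgebra.ι k U (j (w h))) ∈ symGrading k U (∑ h ∈ J, 1) :=
      SetLike.prod_mem_graded _ _ _ fun h _ => ι_mem_symGrading k U _
    have := SetLike.mul_mem_graded h₁
      (SetLike.pow_mem_graded (d - J.card) (ι_mem_symGrading k U (j w₁)))
    convert this using 2
    simp only [Finset.sum_const, smul_eq_mul, mul_one]
    omega
  · rw [map_mul, map_prod, map_pow, hev, hw₁, map_one, one_pow, mul_one]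
    refine Finset.prod_eq_one fun h hh => ?_
    rw [hev, (hwx h (by simpa [J] using hh)).1, map_one]
  · rw [map_mul, map_mul, map_prod, map_prod, Finset.prod_eq_zero (i := h) (by simpa [J] using hh),
      zero_mul]
    rw [symAlgMap_ι, hj, hev, (hwx h hh).2, map_zero]

/-- Sum the translates of a homogeneous interpolating form. Under `ev` those outside `Z` vanish, and
each `z` in `Z` contributes `χ(z) ^ d = 1` because `|Z|` divides `d`. The value `|Z|` is invertible
in characteristic zero. -/
lemma exists_invariant_of_card_dvd [CharZero k] (hj : ∀ h w, σ h (j w) = j (ρ h w))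
    (hev : ∀ w, ev (SymmetricAlgebra.ι k U (j w)) = algebraMap k B (x w)) (hx0 : x ≠ 0)
    (Z : Subgroup H) (hx : ∀ h ∉ Z, ∀ c : k, x ∘ₗ ρ h ≠ c • x) (χ : Z →* kˣ)
    (hZ : ∀ (z : Z) (v : U), σ z v = (χ z : k) • v) :
    ∃ r : ℕ, ∀ d ≥ r, Nat.card Z ∣ d → ∃ q ∈ symGrading k U d,
      (∀ h, symAlgMap (σ h) q = q) ∧ ev q = 1 := by
  classical
  have : Fintype H := Fintype.ofFinite H
  obtain ⟨r, hr⟩ := exists_homogeneous_interpolation hj hev hx0 Z hx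
  refine ⟨r, fun d hd hdvd => ?_⟩
  obtain ⟨e, hed, he, heZ⟩ := hr d hd
  have hN : (Nat.card Z : k) ≠ 0 := Nat.cast_ne_zero.mpr Nat.card_pos.ne'
  refine ⟨(Nat.card Z : k)⁻¹ • ∑ h : H, symAlgMap (σ h) e, ?_, fun g => ?_, ?_⟩
  · exact Submodule.smul_mem _ _ (sum_mem fun h _ => symAlgMap_mem _ hed)
  · rw [map_smul, map_sum]
    congr 1
    simp only [← symAlgMap_rep_mul]
    exact Fintype.sum_equiv (Equiv.mulLeft g) _ _ fun h => rfl
  · have hval : ∀ h : H, ev (symAlgMap (σ h) e) = if h ∈ Z then 1 else 0 := by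
      intro h
      split_ifs with hh
      · have hs : σ h = (χ ⟨h, hh⟩ : k) • LinearMap.id := by ext v; simp [hZ ⟨h, hh⟩ v]
        have hpow : (χ ⟨h, hh⟩ : k) ^ d = 1 := by
          obtain ⟨t, rfl⟩ := hdvd
          rw [← Units.val_pow_eq_pow_val, ← map_pow, pow_mul, pow_card_eq_one', one_pow, map_one,
            Units.val_one]
        rw [hs, ← symMap_apply, symMap_scalar _ hed, hpow, one_smul, he]
      · exact heZ h hh
    rw [map_smul, map_sum, Finset.sum_congr rfl fun h _ => hval h, Finset.sum_boole]
    have hcard : (Finset.univ.filter (· ∈ Z)).card = Nat.card Z := by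
      rw [Nat.card_eq_fintype_card, Fintype.card_subtype]
    rw [hcard, Algebra.smul_def, ← map_natCast (algebraMap k B), ← map_mul, inv_mul_cancel₀ hN,
      map_one]

end Interpolation

/-! ### An equivariant substitution with a retraction -/

section Substitution

variable {k H W V : Type u} [Field k] [Group H]
  [AddCommGroup W] [Module k W] [AddCommGroup V] [Module k V] {n : ℕ}

/-- The retraction `Sym (W^{n + 1}) → Sym V` that evaluates the first copy of `W` at the point `x`
of `W^∨` and sends `w` in the other copies to the multiples `x(w) bᵢ` of the elements of a basis. -/
def evalHom (x : Module.Dual k W) (b : Fin n → V) :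
    SymmetricAlgebra k (DirectSum (Fin (n + 1)) fun _ => W) →ₐ[k] SymmetricAlgebra k V :=
  SymmetricAlgebra.lift (DirectSum.toModule k _ _ fun i =>
    LinearMap.toSpanSingleton k _
      (Fin.cons (α := fun _ => SymmetricAlgebra k V) 1 (fun i => SymmetricAlgebra.ι k V (b i)) i)
      ∘ₗ x)

lemma evalHom_zero (x : Module.Dual k W) (b : Fin n → V) (w : W) :
    evalHom x b (SymmetricAlgebra.ι k _ (DirectSum.lof k _ (fun _ => W) 0 w)) =
      algebraMap k _ (x w) := by
  simp [evalHom, Algebra.algebraMap_eq_smul_one]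

lemma evalHom_succ (x : Module.Dual k W) (b : Fin n → V) (i : Fin n) (w : W) :
    evalHom x b (SymmetricAlgebra.ι k _ (DirectSum.lof k _ (fun _ => W) i.succ w)) =
      x w • SymmetricAlgebra.ι k V (b i) := by
  simp [evalHom]

lemma directSum_lof (ρ : Representation k H W) (i : Fin (n + 1)) (h : H) (w : W) :
    Representation.directSum (fun _ : Fin (n + 1) => ρ) h (DirectSum.lof k _ (fun _ => W) i w) =
      DirectSum.lof k _ (fun _ => W) i (ρ h w) :=
  DirectSum.lmap_lof (fun _ : Fin (n + 1) => ρ h) i w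

/-- The linear map sending `b i` to `e * y i` already has the right image under the retraction,
since `ev e = 1` and `ev (y i) = b i`. Its sum of conjugates over `H` is equivariant, and `ev` kills
every term except `h = 1` because `e` vanishes at the other translates of `x`. No division by `|H|`
is needed. -/
lemma exists_equivariant_section [Finite H] (ρ : Representation k H W) (τ : Representation k H V)
    (b : Module.Basis (Fin n) k V) {x : Module.Dual k W} (hx0 : x ≠ 0)
    (hx : ∀ h ≠ 1, x ∘ₗ ρ h ≠ x) :
    ∃ φ : SymmetricAlgebra k V →ₐ[k] SymmetricAlgebra k (DirectSum (Fin (n + 1)) fun _ => W),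
      (∀ y, evalHom x b (φ y) = y) ∧
      ∀ h y, φ (symAlgMap (τ h) y) =
        symAlgMap (Representation.directSum (fun _ : Fin (n + 1) => ρ) h) (φ y) := by
  classical
  have : Fintype H := Fintype.ofFinite H
  set σ := Representation.directSum (fun _ : Fin (n + 1) => ρ)
  obtain ⟨w, hw⟩ : ∃ w, x w = 1 := by
    obtain ⟨w, hw⟩ : ∃ w, x w ≠ 0 := by
      by_contra! hcon
      exact hx0 (LinearMap.ext hcon)
    exact ⟨(x w)⁻¹ • w, by simp [hw]⟩
  obtain ⟨e, he, he0⟩ := exists_interpolation (σ := σ) (ev := evalHom x b)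
    (directSum_lof ρ 0) (evalHom_zero x b) hx
  let y : Fin n → SymmetricAlgebra k (DirectSum (Fin (n + 1)) fun _ => W) := fun i =>
    SymmetricAlgebra.ι k _ (DirectSum.lof k _ (fun _ => W) i.succ w)
  let φ₀ : V →ₗ[k] SymmetricAlgebra k (DirectSum (Fin (n + 1)) fun _ => W) :=
    ∑ h : H, ∑ i : Fin n,
      (LinearMap.toSpanSingleton k _ (symAlgMap (σ h) (e * y i)) ∘ₗ b.coord i ∘ₗ τ h⁻¹)
  have hφ₀ : ∀ v, φ₀ v = ∑ h : H, ∑ i : Fin n,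
      b.coord i (τ h⁻¹ v) • symAlgMap (σ h) (e * y i) := by
    intro v
    simp [φ₀, LinearMap.sum_apply]
  have hev : ∀ v, evalHom x b (φ₀ v) = SymmetricAlgebra.ι k V v := by
    intro v
    rw [hφ₀, map_sum, Finset.sum_eq_single 1]
    · simp only [symAlgMap_rep_one, map_sum, map_smul]
      simp only [map_mul, he, one_mul, y, evalHom_succ, hw, one_smul, inv_one, map_one,
        Module.End.one_apply]
      conv_rhs => rw [← b.sum_repr v, map_sum]
      simp
    · intro h _ hh
      simp [he0 h hh]
    · simp
  have hequiv : ∀ g v, φ₀ (τ g v) = symAlgMap (σ g) (φ₀ v) := by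
    intro g v
    rw [hφ₀, hφ₀, map_sum]
    refine Fintype.sum_equiv (Equiv.mulLeft g⁻¹) _ _ fun h => ?_
    rw [map_sum]
    refine Finset.sum_congr rfl fun i _ => ?_
    rw [map_smul, ← symAlgMap_rep_mul, ← Module.End.mul_apply, ← map_mul τ]
    simp
  refine ⟨SymmetricAlgebra.lift φ₀, fun y => ?_, fun h y => ?_⟩
  · have : (evalHom x b).comp (SymmetricAlgebra.lift φ₀) = AlgHom.id k _ :=
      SymmetricAlgebra.algHom_ext (by ext v; simp [hev])
    exact DFunLike.congr_fun this y
  · have : (SymmetricAlgebra.lift φ₀).comp (symAlgMap (τ h)) =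
        (symAlgMap (σ h)).comp (SymmetricAlgebra.lift φ₀) :=
      SymmetricAlgebra.algHom_ext (by ext v; simp [hequiv])
    exact DFunLike.congr_fun this y

end Substitution

/-! ### Invariant rational functions as fractions of invariants -/

section Invariants

variable {k H V : Type u} [Field k] [Group H] [Finite H] [AddCommGroup V] [Module k V]
  (τ : Representation k H V) (Z : Subgroup H)

/-- Every nonzero element of `Sym V` divides a nonzero invariant. -/
lemma exists_mul_invariant {b : SymmetricAlgebra k V} (hb : b ≠ 0) :
    ∃ c : SymmetricAlgebra k V, b * c ≠ 0 ∧ ∀ z : Z, symAlgMap (τ z) (b * c) = b * c := by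
  classical
  have : Fintype Z := Fintype.ofFinite Z
  refine ⟨∏ z ∈ Finset.univ.erase (1 : Z), symAlgMap (τ z) b, ?_⟩
  have hprod : b * ∏ z ∈ Finset.univ.erase (1 : Z), symAlgMap (τ z) b =
      ∏ z : Z, symAlgMap (τ z) b := by
    rw [← Finset.mul_prod_erase Finset.univ _ (Finset.mem_univ (1 : Z))]
    rw [Subgroup.coe_one, symAlgMap_rep_one]
  rw [hprod]
  refine ⟨Finset.prod_ne_zero_iff.mpr fun z _ =>
    (map_ne_zero_iff _ (symAlgMap_rep_injective τ z)).mpr hb, fun z => ?_⟩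
  rw [map_prod]
  refine Fintype.prod_equiv (Equiv.mulLeft z) _ _ fun z' => ?_
  rw [← symAlgMap_rep_mul]
  rfl

/-- Expanding the fraction so that the denominator becomes its norm makes the numerator invariant
too, as a product of invariants. -/
lemma exists_invariant_fraction {y : SymFrac k V} (hy : ∀ z : Z, symFracMap τ z y = y) :
    ∃ a b : SymmetricAlgebra k V, b ≠ 0 ∧ (∀ z : Z, symAlgMap (τ z) a = a) ∧
      (∀ z : Z, symAlgMap (τ z) b = b) ∧ y * algebraMap _ _ b = algebraMap _ _ a := by
  obtain ⟨a, b, hb, rfl⟩ := IsFractionRing.div_surjective (A := SymmetricAlgebra k V) y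
  have hb0 : b ≠ 0 := nonZeroDivisors.ne_zero hb
  obtain ⟨c, hc, hcZ⟩ := exists_mul_invariant τ Z hb0
  have hb' : algebraMap (SymmetricAlgebra k V) (SymFrac k V) b ≠ 0 :=
    (map_ne_zero_iff _ (IsFractionRing.injective _ _)).mpr hb0
  have e : algebraMap _ (SymFrac k V) a / algebraMap _ _ b * algebraMap _ _ (b * c) =
      algebraMap _ _ (a * c) := by
    rw [map_mul, map_mul]
    field_simp
  refine ⟨a * c, b * c, hc, fun z => ?_, hcZ, e⟩
  apply IsFractionRing.injective (SymmetricAlgebra k V) (SymFrac k V)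
  rw [← symFracMap_algebraMap, ← e, map_mul, hy, symFracMap_algebraMap, hcZ]

end Invariants

/-! ### Transfer of rational functions from `V` to copies of `W` -/

/-- An equivariant embedding `φ` of `Sym V` in `Sym U` with a retraction `ev` and invariants `q₁`,
`q₂` of degrees `d + N`, `d` with value one embed the invariant rational functions on `V^∨` in the
rational functions on `ℙ(U^∨)`. The embedding is described after composition with a map `ι` to a
larger field. -/
lemma exists_embedding_of_section {k H U V : Type u} [Field k] [Group H] [Finite H]
    [AddCommGroup U] [Module k U] [AddCommGroup V] [Module k V] (σ : Representation k H U)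
    (τ : Representation k H V) (Z : Subgroup H) [IsCyclic Z] (χ : Z →* kˣ)
    (hχ : Function.Injective χ) (hZ : ∀ (z : Z) (u : U), σ z u = (χ z : k) • u)
    (ev : SymmetricAlgebra k U →ₐ[k] SymmetricAlgebra k V)
    (φ : SymmetricAlgebra k V →ₐ[k] SymmetricAlgebra k U) (hφev : ∀ y, ev (φ y) = y)
    (hφ : ∀ h y, φ (symAlgMap (τ h) y) = symAlgMap (σ h) (φ y)) {d : ℕ}
    {q₁ q₂ : SymmetricAlgebra k U} (hq₁ : q₁ ∈ symGrading k U (d + Nat.card Z))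
    (hq₂ : q₂ ∈ symGrading k U d) (i₁ : ∀ h, symAlgMap (σ h) q₁ = q₁)
    (i₂ : ∀ h, symAlgMap (σ h) q₂ = q₂) (e₁ : ev q₁ = 1) (e₂ : ev q₂ = 1) :
    ∃ (F : Type u) (_ : Field F) (ι : SymFrac k U →+* F) (Ξ : SymFrac k V →+* F),
      (∀ c : k, Ξ (algebraMap k _ c) = ι (algebraMap k _ c)) ∧
      ∀ y : SymFrac k V, (∀ z : Z, symFracMap τ z y = y) → ∃ l, IsDegreeZero k U l ∧
        ∀ h, Ξ (symFracMap τ h y) = ι (symFracMap σ h l) := by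
  -- The root `s` need not exist in `SymFrac k U`. No action of `H` on `F` is chosen: equivariance
  -- is recorded by identities in `F`, one for each `h`.
  let F := AlgebraicClosure (SymFrac k U)
  have hinj : Function.Injective (algebraMap (SymmetricAlgebra k U) F) := by
    rw [IsScalarTower.algebraMap_eq (SymmetricAlgebra k U) (SymFrac k U) F, RingHom.coe_comp]
    exact (algebraMap (SymFrac k U) F).injective.comp (IsFractionRing.injective _ _)
  have hne : ∀ {a : SymmetricAlgebra k U}, a ≠ 0 → algebraMap (SymmetricAlgebra k U) F a ≠ 0 :=
    fun h => (map_ne_zero_iff _ hinj).mpr h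
  have hq₁0 : q₁ ≠ 0 := by
    rintro rfl
    simp at e₁
  obtain ⟨s, hs⟩ := IsAlgClosed.exists_pow_nat_eq (algebraMap _ F q₂ / algebraMap _ F q₁)
    (Nat.card_pos (α := Z))
  have hs' : s ^ Nat.card Z * algebraMap _ F q₁ = algebraMap _ F q₂ := by
    rw [hs, div_mul_cancel₀ _ (hne hq₁0)]
  -- One homogenization `A` of `φ Q` works for all translates simultaneously because `q₁` and `q₂`
  -- are invariant.
  have core : ∀ Q : SymmetricAlgebra k V, (∀ z : Z, symAlgMap (τ z) Q = Q) →
      ∃ (R : ℕ) (A : SymmetricAlgebra k U), A ∈ symGrading k U (R * (d + Nat.card Z)) ∧ ev A = Q ∧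
        ∀ h, scaleHom s (φ (symAlgMap (τ h) Q)) * algebraMap _ F q₁ ^ R =
          algebraMap _ F (symAlgMap (σ h) A) := by
    intro Q hQ
    obtain ⟨R, A, hA, hevA, hA'⟩ := exists_homogenization σ (ev : _ →+* SymmetricAlgebra k V)
      hq₁ hq₂ i₁ i₂ e₁ e₂ hs' (P := φ Q) fun m hm =>
        card_dvd_of_component_ne_zero σ χ hχ hZ (fun z => by rw [← hφ, hQ]) hm
    refine ⟨R, A, hA, hevA.trans (hφev Q), fun h => ?_⟩
    rw [hφ, hA']
  -- If `Q` is killed, so is a nonzero invariant multiple `Q * c`; then its homogenization `A` is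
  -- zero, contrary to `ev A = Q * c`.
  have hΞ : Function.Injective ((scaleHom s).comp φ : SymmetricAlgebra k V →+* F) := by
    rw [injective_iff_map_eq_zero]
    intro Q hQ
    by_contra hQ0
    obtain ⟨c, hc, hcZ⟩ := exists_mul_invariant τ Z hQ0
    obtain ⟨R, A, -, hevA, hA⟩ := core (Q * c) hcZ
    have h1 := hA 1
    have hQ' : scaleHom s (φ Q) = 0 := hQ
    rw [symAlgMap_rep_one, symAlgMap_rep_one, map_mul, map_mul, hQ', zero_mul, zero_mul] at h1
    have hA0 : A = 0 := hinj (by rw [← h1, map_zero])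
    exact hc (by rw [← hevA, hA0, map_zero])
  refine ⟨F, inferInstance, algebraMap (SymFrac k U) F, IsFractionRing.lift hΞ, ?_, ?_⟩
  · intro c
    rw [IsScalarTower.algebraMap_apply k (SymmetricAlgebra k V) (SymFrac k V),
      IsFractionRing.lift_algebraMap, ← IsScalarTower.algebraMap_apply]
    exact AlgHom.commutes ((scaleHom s).comp φ) c
  · intro y hy
    obtain ⟨a, b, hb, haZ, hbZ, hyb⟩ := exists_invariant_fraction τ Z hy
    obtain ⟨Ra, A, hA, hevA, hA'⟩ := core a haZ
    obtain ⟨Rb, B, hB, hevB, hB'⟩ := core b hbZ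
    have hB0 : B ≠ 0 := by
      rintro rfl
      exact hb (by rw [← hevB, map_zero])
    -- Numerator and denominator were cleared by the different powers `q₁ ^ Ra` and `q₁ ^ Rb`; the
    -- cross factors restore equal degrees.
    refine ⟨algebraMap _ _ (A * q₁ ^ Rb) / algebraMap _ _ (B * q₁ ^ Ra),
      ⟨(Ra + Rb) * (d + Nat.card Z), _, _, ?_, ?_, ?_, rfl⟩, fun h => ?_⟩
    · have := SetLike.mul_mem_graded hA (SetLike.pow_mem_graded Rb hq₁)
      rwa [smul_eq_mul, ← add_mul] at this
    · have := SetLike.mul_mem_graded hB (SetLike.pow_mem_graded Ra hq₁)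
      rwa [smul_eq_mul, ← add_mul, add_comm Rb Ra] at this
    · exact mul_ne_zero hB0 (pow_ne_zero _ hq₁0)
    · have hyh := congrArg (fun t => IsFractionRing.lift hΞ (symFracMap τ h t)) hyb
      simp only [map_mul, symFracMap_algebraMap, IsFractionRing.lift_algebraMap] at hyh
      simp only [map_div₀, map_mul, map_pow, symFracMap_algebraMap, i₁,
        ← IsScalarTower.algebraMap_apply]
      rw [← hA' h, ← hB' h]
      have hb' : scaleHom s (φ (symAlgMap (τ h) b)) ≠ 0 :=
        (map_ne_zero_iff ((scaleHom s).comp φ : SymmetricAlgebra k V →+* F) hΞ).mpr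
          ((map_ne_zero_iff _ (symAlgMap_rep_injective τ h)).mpr hb)
      have hq := hne hq₁0
      rw [eq_div_iff (mul_ne_zero (mul_ne_zero hb' (pow_ne_zero _ hq)) (pow_ne_zero _ hq))]
      change IsFractionRing.lift hΞ (symFracMap τ h y) * scaleHom s (φ (symAlgMap (τ h) b)) =
        scaleHom s (φ (symAlgMap (τ h) a)) at hyh
      rw [← hyh]
      ring

section Transfer

variable {k H W V : Type u} [Field k] [CharZero k] [Group H] [Finite H]
  [AddCommGroup W] [Module k W] [FiniteDimensional k W] [Nontrivial W]
  [AddCommGroup V] [Module k V] [FiniteDimensional k V]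

/-- The embedding of the invariant rational functions on `V^∨` in the rational functions on
`ℙ((W^{n + 1})^∨)`, where `n = dim V`, in terms of an embedding in some larger field. -/
lemma exists_transfer (ρ : Representation k H W) (τ : Representation k H V) (Z : Subgroup H)
    [IsCyclic Z] (χ : Z →* kˣ) (hχ : Function.Injective χ)
    (hZ : ∀ (z : Z) (w : W), ρ z w = (χ z : k) • w)
    (hscalar : ∀ g : H, (∃ c : k, ∀ w, ρ g w = c • w) → g ∈ Z) {n : ℕ}
    (hn : Module.finrank k V = n) :
    ∃ (F : Type u) (_ : Field F)
      (ι : SymFrac k (DirectSum (Fin (n + 1)) fun _ => W) →+* F) (Ξ : SymFrac k V →+* F),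
      (∀ c : k, Ξ (algebraMap k _ c) = ι (algebraMap k _ c)) ∧
      ∀ y : SymFrac k V, (∀ z : Z, symFracMap τ z y = y) → ∃ l, IsDegreeZero k _ l ∧
        ∀ h, Ξ (symFracMap τ h y) =
          ι (symFracMap (Representation.directSum fun _ : Fin (n + 1) => ρ) h l) := by
  let b : Module.Basis (Fin n) k V := Module.finBasisOfFinrankEq k V hn
  obtain ⟨x, hx0, hx⟩ := exists_dual_not_proportional ρ (Z : Set H) hscalar
  -- Inside `Z` this is faithfulness of `χ`, outside `Z` the choice of `x`.
  have hx1 : ∀ h ≠ 1, x ∘ₗ ρ h ≠ x := by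
    intro h hh he
    by_cases hhZ : h ∈ Z
    · obtain ⟨w, hw⟩ : ∃ w, x w ≠ 0 := by
        by_contra! hcon
        exact hx0 (LinearMap.ext hcon)
      have := DFunLike.congr_fun he w
      rw [LinearMap.comp_apply, hZ ⟨h, hhZ⟩, map_smul, smul_eq_mul, mul_eq_right₀ hw] at this
      exact hh (congrArg Subtype.val (hχ ((Units.ext this).trans (map_one χ).symm)))
    · exact hx h hhZ 1 (by rw [he, one_smul])
  have hσZ : ∀ (z : Z) (u : DirectSum (Fin (n + 1)) fun _ => W),
      Representation.directSum (fun _ : Fin (n + 1) => ρ) z u = (χ z : k) • u := by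
    intro z u
    ext i
    simp [Representation.directSum, hZ z, DirectSum.smul_apply]
  obtain ⟨φ, hφev, hφ⟩ := exists_equivariant_section ρ τ b hx0 hx1
  obtain ⟨r, hr⟩ := exists_invariant_of_card_dvd (ev := evalHom x b)
    (directSum_lof ρ 0) (evalHom_zero x b) hx0 Z hx χ hσZ
  -- Take `d = |Z| * r`, so that `d` and `d + |Z|` are both large enough and divisible by `|Z|`.
  have hrN : r ≤ Nat.card Z * r := Nat.le_mul_of_pos_left r Nat.card_pos
  obtain ⟨q₂, hq₂, i₂, e₂⟩ := hr (Nat.card Z * r) hrN (dvd_mul_right _ _)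
  obtain ⟨q₁, hq₁, i₁, e₁⟩ := hr (Nat.card Z * r + Nat.card Z) (by omega)
    ((dvd_mul_right _ _).add dvd_rfl)
  exact exists_embedding_of_section _ τ Z χ hχ hσZ _ φ hφev hφ hq₁ hq₂ i₁ i₂ e₁ e₂

/-- Transfer of an embedding in the rational functions on `V^∨`, with invariant image, to an
embedding in the rational functions on `ℙ((W^{n + 1})^∨)`, where `n = dim V`. -/
lemma exists_transfer_hom (ρ : Representation k H W) (τ : Representation k H V) (Z : Subgroup H)
    [IsCyclic Z] (χ : Z →* kˣ) (hχ : Function.Injective χ)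
    (hZ : ∀ (z : Z) (w : W), ρ z w = (χ z : k) • w)
    (hscalar : ∀ g : H, (∃ c : k, ∀ w, ρ g w = c • w) → g ∈ Z) {n : ℕ}
    (hn : Module.finrank k V = n) {K : Type u} [Field K] (Φ : K →+* SymFrac k V)
    (hΦ : ∀ (z : Z) (y : K), symFracMap τ z (Φ y) = Φ y) :
    ∃ Ψ : K →+* SymFrac k (DirectSum (Fin (n + 1)) fun _ => W),
      (∀ y, IsDegreeZero k _ (Ψ y)) ∧
      (∀ (c : k) (y : K), Φ y = algebraMap k _ c → Ψ y = algebraMap k _ c) ∧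
      ∀ (h : H) (a : K →+* K), (∀ y, symFracMap τ h (Φ y) = Φ (a y)) → ∀ y,
        symFracMap (Representation.directSum fun _ : Fin (n + 1) => ρ) h (Ψ y) = Ψ (a y) := by
  obtain ⟨F, _, ι, Ξ, hk, hΞ⟩ := exists_transfer ρ τ Z χ hχ hZ hscalar hn
  choose l hl hlh using fun y : K => hΞ (Φ y) fun z => hΦ z y
  have h1 : ∀ y, Ξ (Φ y) = ι (l y) := by
    intro y
    have h1τ : symFracMap τ 1 (Φ y) = Φ y := by simpa using hΦ 1 y
    have h1σ : ∀ t, symFracMap (Representation.directSum fun _ : Fin (n + 1) => ρ) 1 t = t := by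
      intro t
      obtain ⟨a, b, -, rfl⟩ := IsFractionRing.div_surjective
        (A := SymmetricAlgebra k (DirectSum (Fin (n + 1)) fun _ => W)) t
      simp only [map_div₀, symFracMap_algebraMap, symAlgMap_rep_one]
    have := hlh y 1
    rwa [h1τ, h1σ] at this
  -- Since `ι ∘ l = Ξ ∘ Φ` with `ι` injective, the chosen preimages `l` form a ring homomorphism,
  -- and its compatibilities can be tested in `F`.
  have hι := ι.injective
  refine ⟨{ toFun := l, map_one' := hι ?_, map_mul' := fun y z => hι ?_, map_zero' := hι ?_,
            map_add' := fun y z => hι ?_ }, hl, fun c y hy => hι ?_, fun h a ha y => hι ?_⟩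
  · rw [← h1, map_one, map_one, map_one]
  · rw [map_mul, ← h1, ← h1, ← h1, map_mul, map_mul]
  · rw [← h1, map_zero, map_zero, map_zero]
  · rw [map_add, ← h1, ← h1, ← h1, map_add, map_add]
  · change ι (l y) = _
    rw [← h1, hy, hk]
  · change ι (symFracMap _ h (l y)) = ι (l (a y))
    rw [← hlh, ha, h1]

end Transfer

end

end EquivUnirational

namespace EquivUnirational

noncomputable section

/-! ### Restriction of partial maps to generic morphisms -/

section Pull

variable {X Y Y' T T' S : Scheme.{u}}

/-- A morphism is generic if its image is contained in every nonempty open subset. -/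
def IsGenericHom (t : T ⟶ X) : Prop :=
  ∀ U : X.Opens, (U : Set X).Nonempty → ∀ y : T, t y ∈ U

lemma IsGenericHom.comp_left {t : T ⟶ X} (ht : IsGenericHom t) (a : T' ⟶ T) :
    IsGenericHom (a ≫ t) := fun U hU y => by
  rw [Scheme.Hom.comp_apply]
  exact ht U hU _

lemma IsGenericHom.comp_isIso {t : T ⟶ X} (ht : IsGenericHom t) (e : X ⟶ Y) [IsIso e] :
    IsGenericHom (t ≫ e) := fun U ⟨u, hu⟩ y => by
  rw [Scheme.Hom.comp_apply]
  obtain ⟨x, rfl⟩ := e.homeomorph.surjective u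
  exact ht (e ⁻¹ᵁ U) ⟨x, hu⟩ y

lemma IsGenericHom.mem_domain [Nonempty X] {t : T ⟶ X} (ht : IsGenericHom t)
    (f : X.PartialMap Y) (y : T) : t y ∈ f.domain :=
  ht _ f.dense_domain.nonempty y

lemma range_subset_range_ι {t : T ⟶ X} {U : X.Opens} (ht : ∀ y, t y ∈ U) :
    Set.range t ⊆ Set.range U.ι := by
  rintro _ ⟨y, rfl⟩
  simpa using ht y

/-- The composition of a partial map `f` with a morphism to its domain of definition. -/
def pull (f : X.PartialMap Y) (t : T ⟶ X) (ht : ∀ y, t y ∈ f.domain) : T ⟶ Y :=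
  IsOpenImmersion.lift f.domain.ι t (range_subset_range_ι ht) ≫ f.hom

lemma pull_eq (f : X.PartialMap Y) {t : T ⟶ X} (ht : ∀ y, t y ∈ f.domain)
    (u : T ⟶ f.domain) (hu : u ≫ f.domain.ι = t) : pull f t ht = u ≫ f.hom := by
  rw [pull, ← IsOpenImmersion.lift_uniq f.domain.ι t (range_subset_range_ι ht) u hu]

lemma exists_lift_opens (U : X.Opens) {t : T ⟶ X} (ht : ∀ y, t y ∈ U) :
    ∃ u : T ⟶ U, u ≫ U.ι = t :=
  ⟨_, IsOpenImmersion.lift_fac U.ι t (range_subset_range_ι ht)⟩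

lemma comp_pull (f : X.PartialMap Y) {t : T ⟶ X} (ht : ∀ y, t y ∈ f.domain) (a : T' ⟶ T)
    (hat : ∀ y, (a ≫ t) y ∈ f.domain) : a ≫ pull f t ht = pull f (a ≫ t) hat := by
  obtain ⟨u, hu⟩ := exists_lift_opens f.domain ht
  rw [pull_eq f ht u hu, pull_eq f hat (a ≫ u) (by rw [Category.assoc, hu]), Category.assoc]

lemma pull_compHom (f : X.PartialMap Y) {t : T ⟶ X} (ht : ∀ y, t y ∈ f.domain) (g : Y ⟶ Y') :
    pull (f.compHom g) t ht = pull f t ht ≫ g := by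
  obtain ⟨u, hu⟩ := exists_lift_opens f.domain ht
  rw [pull_eq f ht u hu, pull_eq (f.compHom g) ht u hu, Category.assoc]
  rfl

lemma pull_precompIso (e : X ⟶ Y) [IsIso e] (f : Y.PartialMap Y') {t : T ⟶ X}
    (ht : ∀ y, t y ∈ (precompIso e f).domain) (hte : ∀ y, (t ≫ e) y ∈ f.domain) :
    pull (precompIso e f) t ht = pull f (t ≫ e) hte := by
  obtain ⟨u, hu⟩ := exists_lift_opens (e ⁻¹ᵁ f.domain) ht
  rw [pull_eq f hte (u ≫ (e ∣_ f.domain))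
    (by rw [Category.assoc, morphismRestrict_ι, ← hu, Category.assoc]), Category.assoc]
  exact pull_eq (precompIso e f) ht u hu

lemma pull_over (f : X.PartialMap Y) {t : T ⟶ X} (ht : ∀ y, t y ∈ f.domain) {p : X ⟶ S}
    {q : Y ⟶ S} (hf : f.hom ≫ q = f.domain.ι ≫ p) : pull f t ht ≫ q = t ≫ p := by
  obtain ⟨u, hu⟩ := exists_lift_opens f.domain ht
  rw [pull_eq f ht u hu, Category.assoc, hf, reassoc_of% hu]

/-- The two representatives agree on a dense open subset, which a generic morphism cannot miss. -/
lemma pull_eq_of_toRationalMap_eq [Nonempty X] {f g : X.PartialMap Y}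
    (h : f.toRationalMap = g.toRationalMap) {t : T ⟶ X} (ht : IsGenericHom t) :
    pull f t (ht.mem_domain f) = pull g t (ht.mem_domain g) := by
  obtain ⟨W, hW, hWf, hWg, e⟩ := Scheme.PartialMap.toRationalMap_eq_iff.mp h
  obtain ⟨u, hu⟩ := exists_lift_opens W (ht W (hW.nonempty))
  rw [pull_eq f _ (u ≫ X.homOfLE hWf) (by rw [Category.assoc, X.homOfLE_ι, hu]),
    pull_eq g _ (u ≫ X.homOfLE hWg) (by rw [Category.assoc, X.homOfLE_ι, hu])]
  rw [Category.assoc, Category.assoc]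
  exact congrArg (u ≫ ·) e

lemma fromSpecStalkOfMem_eq_pull (f : X.PartialMap Y) {x : X} (hx : x ∈ f.domain)
    (ht : ∀ y, X.fromSpecStalk x y ∈ f.domain) :
    f.fromSpecStalkOfMem hx = pull f (X.fromSpecStalk x) ht :=
  (pull_eq f ht _ (Scheme.Opens.fromSpecStalkOfMem_ι _ _ hx)).symm

/-- By dominance the preimage of a nonempty open subset of `Y` is a nonempty open subset of `X`,
hence contains the image of `t`. -/
lemma IsGenericHom.pull [Nonempty X] {f : X.PartialMap Y} [IsDominant f.hom] {t : T ⟶ X}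
    (ht : IsGenericHom t) : IsGenericHom (pull f t (ht.mem_domain f)) := by
  intro U hU y
  obtain ⟨u, hu⟩ := exists_lift_opens f.domain (ht.mem_domain f)
  rw [pull_eq f _ u hu, Scheme.Hom.comp_apply]
  obtain ⟨z, hz⟩ := (IsDominant.denseRange (f := f.hom)).exists_mem_open U.2 hU
  have hne : ((f.domain.ι ''ᵁ (f.hom ⁻¹ᵁ U) : X.Opens) : Set X).Nonempty :=
    ⟨f.domain.ι z, z, hz, rfl⟩
  obtain ⟨z', hz', hzt⟩ := ht _ hne y
  rw [← hu, Scheme.Hom.comp_apply] at hzt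
  have := f.domain.ι.isOpenEmbedding.injective hzt
  rw [← this]
  exact hz'

lemma IsGenericHom.apply_eq_genericPoint [IrreducibleSpace X] {t : T ⟶ X} (ht : IsGenericHom t)
    (y : T) : t y = genericPoint X := by
  refine IsGenericPoint.eq (S := Set.univ) ?_ (genericPoint_spec X)
  rw [isGenericPoint_iff_forall_closed isClosed_univ (Set.mem_univ _)]
  intro Z hZ hy
  by_contra hne
  obtain ⟨z, -, hz⟩ := Set.not_subset.mp hne
  exact ht ⟨Zᶜ, hZ.isOpen_compl⟩ ⟨z, hz⟩ y hy

/-- The inclusion of the generic point. -/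
abbrev genericι (X : Scheme.{u}) [IrreducibleSpace X] : Spec X.functionField ⟶ X :=
  X.fromSpecStalk (genericPoint X)

lemma isGenericHom_genericι (X : Scheme.{u}) [IsIntegral X] : IsGenericHom (genericι X) := by
  intro U hU y
  have hy : y = IsLocalRing.closedPoint X.functionField := by
    have : Subsingleton (PrimeSpectrum X.functionField) := inferInstance
    exact this.elim _ _
  rw [hy, Scheme.fromSpecStalk_closedPoint]
  exact (genericPoint_spec X).mem_open_set_iff U.2 |>.mpr (by simpa using hU)

/-- A generic point with values in a local ring comes from the function field. -/
lemma IsGenericHom.exists_functionField_hom [IsIntegral X] {R : CommRingCat.{u}} [IsLocalRing R]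
    {t : Spec R ⟶ X} (ht : IsGenericHom t) :
    ∃ φ : X.functionField ⟶ R, Spec.map φ ≫ genericι X = t := by
  -- A variable point `x` avoids transporting stalks along the equality with the generic point.
  have key : ∀ x : X, t (IsLocalRing.closedPoint R) = x →
      ∃ φ : X.presheaf.stalk x ⟶ R, Spec.map φ ≫ X.fromSpecStalk x = t := by
    rintro _ rfl
    exact ⟨_, Scheme.Spec_stalkClosedPointTo_fromSpecStalk t⟩
  exact key _ (ht.apply_eq_genericPoint _)

/-- Such a morphism is faithfully flat. This allows equalities over the function field of projective
space to be checked over `SymFrac k V`, where the group action is explicit. -/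
lemma epi_SpecMap_of_isField {K L : CommRingCat.{u}} (hK : IsField K) [Nontrivial L]
    (φ : K ⟶ L) : Epi (Spec.map φ) := by
  let := hK.toField
  have : Flat (Spec.map φ) := by
    rw [Flat.SpecMap_iff]
    algebraize [φ.hom]
    change Module.Flat K L
    infer_instance
  have : Surjective (Spec.map φ) := by
    have hs : Subsingleton (PrimeSpectrum K) := inferInstance
    obtain ⟨x⟩ : Nonempty (PrimeSpectrum L) := inferInstance
    exact ⟨fun y => ⟨x, hs.elim _ _⟩⟩
  exact Flat.epi_of_flat_of_surjective _

/-- A morphism from the function field of an integral scheme spreads out to a dominant partial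
map. Its equivariance can be tested after a field extension. -/
lemma exists_partialMap [IsIntegral X] [IsIntegral Y] {p : X ⟶ S} {q : Y ⟶ S}
    [LocallyOfFiniteType q] (ψ : Y.functionField ⟶ X.functionField)
    (hψ : Spec.map ψ ≫ genericι Y ≫ q = genericι X ≫ p) :
    ∃ f : X.PartialMap Y, f.hom ≫ q = f.domain.ι ≫ p ∧ IsDominant f.hom ∧
      pull f (genericι X) ((isGenericHom_genericι X).mem_domain f) =
        Spec.map ψ ≫ genericι Y := by
  let φ : Spec X.functionField ⟶ Y := Spec.map ψ ≫ genericι Y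
  have hφ : φ ≫ q = X.fromSpecStalk (genericPoint X) ≫ p :=
    (Category.assoc _ _ _).trans hψ
  let f := Scheme.PartialMap.ofFromSpecStalk p q φ hφ
  have hpull : pull f (genericι X) ((isGenericHom_genericι X).mem_domain f) = φ := by
    rw [← fromSpecStalkOfMem_eq_pull f (Scheme.PartialMap.mem_domain_ofFromSpecStalk p q φ hφ)]
    exact Scheme.PartialMap.fromSpecStalkOfMem_ofFromSpecStalk p q φ hφ
  refine ⟨f, Scheme.PartialMap.ofFromSpecStalk_comp p q φ hφ, ⟨?_⟩, hpull⟩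
  obtain ⟨u, hu⟩ := exists_lift_opens f.domain ((isGenericHom_genericι X).mem_domain f)
  rw [pull_eq f _ u hu] at hpull
  -- Dominance follows because the image contains the generic point of `Y`.
  have hgen : genericPoint Y ∈ Set.range f.hom := by
    let y : Spec X.functionField := IsLocalRing.closedPoint X.functionField
    refine ⟨u y, ?_⟩
    rw [← Scheme.Hom.comp_apply, hpull]
    exact ((isGenericHom_genericι Y).comp_left _).apply_eq_genericPoint y
  intro y
  exact closure_mono (Set.singleton_subset_iff.mpr hgen) ((genericPoint_spec Y).symm ▸ trivial)

lemma toRationalMap_eq_of_pull_eq [IsIntegral X] {f g : X.PartialMap Y}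
    (h : pull f (genericι X) ((isGenericHom_genericι X).mem_domain f) =
      pull g (genericι X) ((isGenericHom_genericι X).mem_domain g)) :
    f.toRationalMap = g.toRationalMap := by
  apply Scheme.RationalMap.eq_of_fromFunctionField_eq
  rw [Scheme.RationalMap.fromFunctionField_toRationalMap,
    Scheme.RationalMap.fromFunctionField_toRationalMap]
  rw [Scheme.PartialMap.fromFunctionField, Scheme.PartialMap.fromFunctionField,
    fromSpecStalkOfMem_eq_pull, fromSpecStalkOfMem_eq_pull]
  exact h

end Pull

end

end EquivUnirational

namespace EquivUnirational

noncomputable section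

/-! ### The generic point of projective space -/

section ProjGeneric

variable {k V : Type u} [Field k] [AddCommGroup V] [Module k V]

lemma symι_ne_zero {v : V} (hv : v ≠ 0) : SymmetricAlgebra.ι k V v ≠ 0 := by
  intro h
  refine hv ((Module.forall_dual_apply_eq_zero_iff k v).mp fun f => ?_)
  have := congrArg (SymmetricAlgebra.lift f) h
  rwa [SymmetricAlgebra.lift_ι_apply, map_zero] at this

lemma algebraMap_symFrac_ne_zero {b : SymmetricAlgebra k V} (hb : b ≠ 0) :
    algebraMap _ (SymFrac k V) b ≠ 0 :=
  (map_ne_zero_iff _ (IsFractionRing.injective _ _)).mpr hb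

/-- The inclusion of the functions on a basic open subset of `ℙ(V^∨)` in the rational functions
on `V^∨`. -/
def awayToFrac {b : SymmetricAlgebra k V} (hb : b ≠ 0) :
    HomogeneousLocalization.Away (symGrading k V) b →+* SymFrac k V :=
  (IsLocalization.lift (M := Submonoid.powers b) (S := Localization.Away b)
    (g := algebraMap (SymmetricAlgebra k V) (SymFrac k V)) (by
      rintro ⟨_, n, rfl⟩
      exact (isUnit_iff_ne_zero.mpr (algebraMap_symFrac_ne_zero (pow_ne_zero n hb))))).comp
    (algebraMap (HomogeneousLocalization.Away (symGrading k V) b) (Localization.Away b))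

lemma awayToFrac_mk {b : SymmetricAlgebra k V} (hb : b ≠ 0) {d : ℕ} (hbd : b ∈ symGrading k V d)
    (n : ℕ) (a : SymmetricAlgebra k V) (ha : a ∈ symGrading k V (n • d)) :
    awayToFrac hb (HomogeneousLocalization.Away.mk (symGrading k V) hbd n a ha) =
      algebraMap _ _ a / algebraMap _ _ b ^ n := by
  rw [awayToFrac, RingHom.comp_apply, HomogeneousLocalization.algebraMap_apply,
    HomogeneousLocalization.Away.val_mk, Localization.mk_eq_mk', IsLocalization.lift_mk'_spec,
    map_pow]
  exact (mul_div_cancel₀ _ (pow_ne_zero _ (algebraMap_symFrac_ne_zero hb))).symm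

/-- The morphism to `ℙ(V^∨)` from its generic point, via the basic open subset of `b`. -/
def genericVia {b : SymmetricAlgebra k V} (hb : b ≠ 0) {d : ℕ} (hbd : b ∈ symGrading k V d)
    (hd : 0 < d) : Spec (.of (SymFrac k V)) ⟶ projSpace k V :=
  Spec.map (CommRingCat.ofHom (awayToFrac hb)) ≫ Proj.awayι (symGrading k V) b hbd hd

/-- The chart of `b * c` lies in that of `b`, and both coordinate rings embed compatibly in the
fraction field. Passing to a common product makes the generic morphism independent of the chart. -/
lemma genericVia_mul {b c : SymmetricAlgebra k V} (hb : b ≠ 0) {d : ℕ}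
    (hbd : b ∈ symGrading k V d) (hd : 0 < d) {e : ℕ} (hce : c ∈ symGrading k V e)
    {x : SymmetricAlgebra k V} (hx : x = b * c) (hx0 : x ≠ 0) {m : ℕ}
    (hxm : x ∈ symGrading k V m) (hm : 0 < m) (hde : m = d + e) :
    genericVia hb hbd hd = genericVia hx0 hxm hm := by
  subst hde
  have h1 : (awayToFrac hx0).comp (HomogeneousLocalization.awayMap (symGrading k V) hce hx) =
      awayToFrac hb := by
    refine RingHom.ext fun a => ?_
    obtain ⟨n, a, ha, rfl⟩ := a.mk_surjective _ hbd
    subst hx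
    rw [RingHom.comp_apply, HomogeneousLocalization.awayMap_mk, awayToFrac_mk, awayToFrac_mk,
      map_mul, map_mul, map_pow, mul_pow]
    have hc := algebraMap_symFrac_ne_zero (right_ne_zero_of_mul hx0)
    rw [mul_div_mul_right _ _ (pow_ne_zero n hc)]
  rw [genericVia, genericVia, ← Proj.SpecMap_awayMap_awayι (symGrading k V) hbd hd hce hx,
    ← Spec.map_comp_assoc, ← CommRingCat.ofHom_comp, h1]

lemma genericVia_eq {b c : SymmetricAlgebra k V} (hb : b ≠ 0) {d : ℕ}
    (hbd : b ∈ symGrading k V d) (hd : 0 < d) (hc : c ≠ 0) {e : ℕ}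
    (hce : c ∈ symGrading k V e) (he : 0 < e) :
    genericVia hb hbd hd = genericVia hc hce he := by
  have hm := SetLike.mul_mem_graded hbd hce
  rw [genericVia_mul hb hbd hd hce rfl (mul_ne_zero hb hc) hm (by omega) rfl,
    genericVia_mul hc hce he hbd (mul_comm b c) (mul_ne_zero hb hc) hm (by omega) (add_comm d e)]

lemma genericVia_mem_basicOpen {b : SymmetricAlgebra k V} (hb : b ≠ 0) {d : ℕ}
    (hbd : b ∈ symGrading k V d) (hd : 0 < d) (y : Spec (.of (SymFrac k V))) :
    genericVia hb hbd hd y ∈ Proj.basicOpen (symGrading k V) b := by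
  rw [← Proj.opensRange_awayι (symGrading k V) b hbd hd, genericVia, Scheme.Hom.comp_apply]
  exact ⟨_, rfl⟩

/-- A nonempty open subset contains a nonempty basic open subset of a form `a'`; computed in the
chart of `b * a'`, the morphism visibly lands there. -/
lemma isGenericHom_genericVia {b : SymmetricAlgebra k V} (hb : b ≠ 0) {d : ℕ}
    (hbd : b ∈ symGrading k V d) (hd : 0 < d) : IsGenericHom (genericVia hb hbd hd) := by
  rintro U ⟨x, hx⟩ y
  obtain ⟨_, ⟨a, rfl⟩, hxa, haU⟩ :=
    (TopologicalSpace.Opens.isBasis_iff_nbhd.mp (Proj.isBasis_basicOpen (symGrading k V))) hx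
  refine haU ?_
  rw [Proj.basicOpen_eq_iSup_proj, TopologicalSpace.Opens.mem_iSup] at hxa ⊢
  obtain ⟨i, hxi⟩ := hxa
  refine ⟨i, ?_⟩
  have ha0 : GradedRing.proj (symGrading k V) i a ≠ 0 := by
    intro h0
    rw [h0, Proj.basicOpen_zero] at hxi
    exact hxi
  have hai : GradedRing.proj (symGrading k V) i a ∈ symGrading k V i := SetLike.coe_mem _
  rw [genericVia_mul hb hbd hd hai rfl (mul_ne_zero hb ha0) (SetLike.mul_mem_graded hbd hai)
    (by omega) rfl]
  exact Proj.basicOpen_mono _ _ _ (dvd_mul_left _ b) (genericVia_mem_basicOpen _ _ _ y)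

lemma genericVia_str {b : SymmetricAlgebra k V} (hb : b ≠ 0) {d : ℕ}
    (hbd : b ∈ symGrading k V d) (hd : 0 < d) : genericVia hb hbd hd ≫ projSpaceStr k V =
      Spec.map (CommRingCat.ofHom (algebraMap k (SymFrac k V))) := by
  rw [genericVia, projSpaceStr, Category.assoc, Proj.awayι_toSpecZero_assoc]
  simp only [← Spec.map_comp, ← CommRingCat.ofHom_comp]
  congr 2
  refine RingHom.ext fun a => ?_
  have hmem : algebraMap k (SymmetricAlgebra k V) a ∈ symGrading k V (0 • d) := by
    rw [zero_smul]
    exact (algebraMap k (symGrading k V 0) a).2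
  have : HomogeneousLocalization.fromZeroRingHom (symGrading k V) (Submonoid.powers b)
      (algebraMap k (symGrading k V 0) a) =
      HomogeneousLocalization.Away.mk (symGrading k V) hbd 0 (algebraMap k _ a) hmem := by
    refine HomogeneousLocalization.val_injective _ ?_
    rw [HomogeneousLocalization.Away.val_mk]
    change Localization.mk _ _ = Localization.mk _ _
    congr 1
    exact Subtype.ext (pow_zero b).symm
  rw [RingHom.comp_apply, RingHom.comp_apply, this, awayToFrac_mk, pow_zero, div_one,
    ← IsScalarTower.algebraMap_apply]

/-- The action carries the chart of `h b` to that of `b`, so the generic morphism on the right is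
rewritten through the chart of `h b`; both sides are then the same map on fractions `a / b ^ n`. -/
lemma SpecMap_symFracMap_genericVia {H : Type u} [Group H] (ρ : Representation k H V) (h : H)
    {b : SymmetricAlgebra k V} (hb : b ≠ 0) {d : ℕ} (hbd : b ∈ symGrading k V d) (hd : 0 < d) :
    Spec.map (CommRingCat.ofHom (symFracMap ρ h)) ≫ genericVia hb hbd hd =
      genericVia hb hbd hd ≫ (projAction ρ).act h := by
  have hb' : symMap (ρ h) b ≠ 0 := (map_ne_zero_iff _ (symAlgMap_rep_injective ρ h)).mpr hb
  rw [genericVia_eq hb hbd hd hb' (symMap_mem (ρ h) hbd) hd]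
  conv_rhs => rw [genericVia, projAction, Category.assoc, Proj.awayι_comp_map _ _ hd _ hbd]
  rw [← genericVia_eq hb hbd hd hb' (symMap_mem (ρ h) hbd) hd, genericVia, ← Spec.map_comp_assoc,
    ← Spec.map_comp_assoc, ← CommRingCat.ofHom_comp, ← CommRingCat.ofHom_comp]
  congr 3
  refine RingHom.ext fun a => ?_
  obtain ⟨n, a, ha, rfl⟩ := a.mk_surjective _ hbd
  rw [RingHom.comp_apply, RingHom.comp_apply, HomogeneousLocalization.Away.map_mk, awayToFrac_mk,
    awayToFrac_mk, map_div₀, map_pow, symFracMap_algebraMap, symFracMap_algebraMap]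
  rfl

section Nontrivial

variable (k V) [Nontrivial V]

lemma exists_genericVia : ∃ (t : Spec (.of (SymFrac k V)) ⟶ projSpace k V),
    ∀ (b : SymmetricAlgebra k V) (hb : b ≠ 0) (d : ℕ) (hbd : b ∈ symGrading k V d) (hd : 0 < d),
      t = genericVia hb hbd hd := by
  obtain ⟨v, hv⟩ := exists_ne (0 : V)
  exact ⟨genericVia (symι_ne_zero (k := k) hv) (ι_mem_symGrading k V v) one_pos,
    fun b hb d hbd hd => genericVia_eq _ _ _ _ _ _⟩

/-- The morphism `Spec k(V^∨) ⟶ ℙ(V^∨)` to the generic point. -/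
def projGeneric : Spec (.of (SymFrac k V)) ⟶ projSpace k V := (exists_genericVia k V).choose

lemma projGeneric_eq {b : SymmetricAlgebra k V} (hb : b ≠ 0) {d : ℕ}
    (hbd : b ∈ symGrading k V d) (hd : 0 < d) : projGeneric k V = genericVia hb hbd hd :=
  (exists_genericVia k V).choose_spec b hb d hbd hd

lemma isGenericHom_projGeneric : IsGenericHom (projGeneric k V) := by
  obtain ⟨v, hv⟩ := exists_ne (0 : V)
  rw [projGeneric_eq k V (symι_ne_zero hv) (ι_mem_symGrading k V v) one_pos]
  exact isGenericHom_genericVia _ _ _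

lemma projGeneric_str : projGeneric k V ≫ projSpaceStr k V =
    Spec.map (CommRingCat.ofHom (algebraMap k (SymFrac k V))) := by
  obtain ⟨v, hv⟩ := exists_ne (0 : V)
  rw [projGeneric_eq k V (symι_ne_zero hv) (ι_mem_symGrading k V v) one_pos]
  exact genericVia_str _ _ _

variable {k V} in
lemma SpecMap_symFracMap_projGeneric {H : Type u} [Group H] (ρ : Representation k H V) (h : H) :
    Spec.map (CommRingCat.ofHom (symFracMap ρ h)) ≫ projGeneric k V =
      projGeneric k V ≫ (projAction ρ).act h := by
  obtain ⟨v, hv⟩ := exists_ne (0 : V)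
  rw [projGeneric_eq k V (symι_ne_zero hv) (ι_mem_symGrading k V v) one_pos]
  exact SpecMap_symFracMap_genericVia ρ h _ _ _

instance nonempty_projSpace : Nonempty (projSpace k V) :=
  ⟨projGeneric k V (IsLocalRing.closedPoint (SymFrac k V))⟩

/-- The chart rings embed in localizations of the domain `Sym V`, and any two nonempty open subsets
both contain the image of `projGeneric`. -/
instance isIntegral_projSpace : IsIntegral (projSpace k V) := by
  have h1 : IsReduced (projSpace k V) := by
    have : ∀ i, IsReduced ((Proj.affineOpenCover (symGrading k V)).openCover.X i) := by
      intro i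
      change IsReduced (Spec (.of (HomogeneousLocalization.Away (symGrading k V) i.2.1)))
      rw [affine_isReduced_iff]
      exact isReduced_of_injective (algebraMap
        (HomogeneousLocalization.Away (symGrading k V) i.2.1) (Localization.Away i.2.1))
        (HomogeneousLocalization.val_injective _)
    exact IsReduced.of_openCover _ (Proj.affineOpenCover (symGrading k V)).openCover
  have h2 : IrreducibleSpace (projSpace k V) := by
    have : PreirreducibleSpace (projSpace k V) := by
      refine ⟨fun U U' hU hU' ⟨x, hx⟩ ⟨x', hx'⟩ => ?_⟩
      let y := IsLocalRing.closedPoint (SymFrac k V)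
      exact ⟨projGeneric k V y, trivial,
        isGenericHom_projGeneric k V ⟨U, hU⟩ ⟨x, hx.2⟩ y,
        isGenericHom_projGeneric k V ⟨U', hU'⟩ ⟨x', hx'.2⟩ y⟩
    exact ⟨inferInstance⟩
  exact isIntegral_of_irreducibleSpace_of_isReduced _

variable {k V} in
/-- Rational functions on `V^∨` of degree zero come from the function field of `ℙ(V^∨)`. -/
lemma IsDegreeZero.mem_range {ι : (projSpace k V).functionField ⟶ .of (SymFrac k V)}
    (hι : Spec.map ι ≫ genericι (projSpace k V) = projGeneric k V)
    {y : SymFrac k V} (hy : IsDegreeZero k V y) : y ∈ ι.hom.range := by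
  obtain ⟨n, a, b, ha, hb, hb0, rfl⟩ := hy
  -- The degree `n` may be zero, but charts need a form of positive degree; the fraction is
  -- therefore expanded by a linear form `c`.
  obtain ⟨v, hv⟩ := exists_ne (0 : V)
  set c := SymmetricAlgebra.ι k V v
  have hc0 : c ≠ 0 := symι_ne_zero hv
  have hc : c ∈ symGrading k V 1 := ι_mem_symGrading k V v
  have hbc0 : b * c ≠ 0 := mul_ne_zero hb0 hc0
  have hbc := SetLike.mul_mem_graded hb hc
  have hac := SetLike.mul_mem_graded ha hc
  have hac' : a * c ∈ symGrading k V (1 • (n + 1)) := by rwa [one_smul]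
  have hrange : Set.range (genericι (projSpace k V)) ⊆
      Set.range (Proj.awayι (symGrading k V) (b * c) hbc n.succ_pos) := by
    rintro _ ⟨y, rfl⟩
    refine isGenericHom_genericι (projSpace k V)
      (Proj.awayι (symGrading k V) (b * c) hbc n.succ_pos).opensRange ?_ y
    rw [Proj.opensRange_awayι]
    exact ⟨_, genericVia_mem_basicOpen hbc0 hbc n.succ_pos
      (IsLocalRing.closedPoint (SymFrac k V))⟩
  let u := Spec.preimage (IsOpenImmersion.lift
    (Proj.awayι (symGrading k V) (b * c) hbc n.succ_pos) (genericι (projSpace k V)) hrange)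
  have hu : Spec.map u ≫ Proj.awayι (symGrading k V) (b * c) hbc n.succ_pos =
      genericι (projSpace k V) := by
    rw [Spec.map_preimage, IsOpenImmersion.lift_fac]
  have hcomp : u ≫ ι = CommRingCat.ofHom (awayToFrac hbc0) := by
    apply Spec.map_injective
    rw [← cancel_mono (Proj.awayι (symGrading k V) (b * c) hbc n.succ_pos), Spec.map_comp,
      Category.assoc, hu, hι, projGeneric_eq k V hbc0 hbc n.succ_pos, genericVia]
  refine ⟨u.hom (HomogeneousLocalization.Away.mk (symGrading k V) hbc 1 (a * c) hac'), ?_⟩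
  have := congrArg (fun f => f.hom (HomogeneousLocalization.Away.mk (symGrading k V) hbc 1
    (a * c) hac')) hcomp
  refine this.trans ?_
  change awayToFrac hbc0 _ = _
  rw [awayToFrac_mk, pow_one, map_mul, map_mul,
    mul_div_mul_right _ _ (algebraMap_symFrac_ne_zero hc0)]

end Nontrivial

end ProjGeneric

end

end EquivUnirational

namespace EquivUnirational

noncomputable section

/-! ### Transfer of dominant equivariant rational maps -/

/-- For `V = 0` the irrelevant ideal is zero and lies in every prime. Thus a dominant map to a
nonempty scheme forces `V ≠ 0`. -/
lemma isEmpty_projSpace (k V : Type u) [Field k] [AddCommGroup V] [Module k V] [Subsingleton V] :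
    IsEmpty (projSpace k V) := by
  refine ⟨fun x => x.not_irrelevant_le ?_⟩
  rw [HomogeneousIdeal.irrelevant_le]
  intro i hi a ha
  have hbot : LinearMap.range (SymmetricAlgebra.ι k V) = ⊥ := by
    rw [LinearMap.range_eq_bot]
    exact Subsingleton.elim _ _
  have ha0 : a = 0 := by
    change a ∈ LinearMap.range (SymmetricAlgebra.ι k V) ^ i at ha
    rwa [hbot, Submodule.bot_pow hi.ne', Submodule.mem_bot] at ha
  rw [ha0]
  exact zero_mem _

section Descent

variable {k H V : Type u} [Field k] [Group H] [AddCommGroup V] [Module k V]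
  {X : Scheme.{u}} {p : X ⟶ Spec (.of k)} [IsIntegral X]

/-- The action on the function field. -/
lemma exists_functionField_act (β : RightAction H p) (h : H) :
    ∃ a : X.functionField ⟶ X.functionField, Spec.map a ≫ genericι X = genericι X ≫ β.act h :=
  ((isGenericHom_genericι X).comp_isIso (β.act h)).exists_functionField_hom

lemma nontrivial_of_existsDominantEquivariantMap {β : RightAction H p}
    {τ : Representation k H V} (hf : ExistsDominantEquivariantMap (projAction τ) β) :
    Nontrivial V := by
  obtain ⟨f, -, hdom, -⟩ := hf
  by_contra hV
  have : Subsingleton V := not_nontrivial_iff_subsingleton.mp hV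
  obtain ⟨y, -⟩ := (f.hom.denseRange).exists_mem_open isOpen_univ
    (Set.univ_nonempty (α := X))
  exact (isEmpty_projSpace k V).false (f.domain.ι y)

/-- A dominant equivariant rational map from `ℙ(V^∨)` gives an equivariant embedding of the
function field in the rational functions on `V^∨`. -/
lemma exists_functionField_embedding {β : RightAction H p} {τ : Representation k H V}
    (hf : ExistsDominantEquivariantMap (projAction τ) β) :
    ∃ Φ : X.functionField ⟶ .of (SymFrac k V),
      Spec.map Φ ≫ genericι X ≫ p = Spec.map (CommRingCat.ofHom (algebraMap k (SymFrac k V))) ∧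
      ∀ (h : H) (a : X.functionField ⟶ X.functionField),
        Spec.map a ≫ genericι X = genericι X ≫ β.act h →
        Φ ≫ CommRingCat.ofHom (symFracMap τ h) = a ≫ Φ := by
  have := nontrivial_of_existsDominantEquivariantMap hf
  obtain ⟨f, hfp, hdom, hfe⟩ := hf
  have ht := isGenericHom_projGeneric k V
  have : IsLocalRing (CommRingCat.of (SymFrac k V)) :=
    inferInstanceAs (IsLocalRing (SymFrac k V))
  obtain ⟨Φ, hΦ⟩ := (ht.pull (f := f)).exists_functionField_hom
  refine ⟨Φ, ?_, fun h a ha => ?_⟩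
  · rw [reassoc_of% hΦ, pull_over f _ hfp, projGeneric_str]
  · apply Spec.map_injective
    rw [← cancel_mono (genericι X), Spec.map_comp, Spec.map_comp, Category.assoc, Category.assoc,
      ha, reassoc_of% hΦ, hΦ]
    have hte := ht.comp_isIso ((projAction τ).act h)
    -- Equality of the two rational maps, evaluated at the generic morphism, moves the action on `X`
    -- to projective space, where it is `symFracMap`.
    rw [← pull_compHom, ← pull_eq_of_toRationalMap_eq (hfe h) ht,
      pull_precompIso _ _ _ (hte.mem_domain f), comp_pull _ _ _ ((ht.comp_left _).mem_domain f)]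
    congr 1
    exact SpecMap_symFracMap_projGeneric τ h

/-- Conversely, an equivariant embedding of the function field in the rational functions on
`ℙ(V^∨)` gives a dominant equivariant rational map. -/
lemma existsDominantEquivariantMap_of_embedding [Nontrivial V] [LocallyOfFiniteType p]
    {β : RightAction H p} {τ : Representation k H V} (Ψ : X.functionField ⟶ .of (SymFrac k V))
    (hΨ : ∀ y, IsDegreeZero k V (Ψ.hom y))
    (hk : Spec.map Ψ ≫ genericι X ≫ p =
      Spec.map (CommRingCat.ofHom (algebraMap k (SymFrac k V))))
    (he : ∀ (h : H) (a : X.functionField ⟶ X.functionField),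
      Spec.map a ≫ genericι X = genericι X ≫ β.act h →
      Ψ ≫ CommRingCat.ofHom (symFracMap τ h) = a ≫ Ψ) :
    ExistsDominantEquivariantMap (projAction τ) β := by
  have : IsLocalRing (CommRingCat.of (SymFrac k V)) :=
    inferInstanceAs (IsLocalRing (SymFrac k V))
  obtain ⟨ι, hι⟩ := (isGenericHom_projGeneric k V).exists_functionField_hom
  have hfield : IsField (projSpace k V).functionField :=
    Field.toIsField (projSpace k V).functionField
  have hepi : Epi (Spec.map ι) := epi_SpecMap_of_isField hfield ι
  have hinj : Function.Injective ι.hom :=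
    RingHom.injective (R := (projSpace k V).functionField) ι.hom
  -- Functions of degree zero lie in the range of `ι`; inverting `ι` there lets `Ψ` factor through
  -- the function field of projective space.
  let e := RingEquiv.ofBijective ι.hom.rangeRestrict
    ⟨fun a b hab => hinj (congrArg Subtype.val hab), ι.hom.rangeRestrict_surjective⟩
  let ψ : X.functionField ⟶ (projSpace k V).functionField := CommRingCat.ofHom
    ((e.symm : ι.hom.range →+* (projSpace k V).functionField).comp
      (Ψ.hom.codRestrict ι.hom.range fun y => (hΨ y).mem_range hι))
  have hψι : ψ ≫ ι = Ψ := by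
    ext y
    exact congrArg Subtype.val (e.apply_symm_apply
      (Ψ.hom.codRestrict ι.hom.range (fun y => (hΨ y).mem_range hι) y))
  obtain ⟨f, hfp, hdom, hpull⟩ := exists_partialMap (p := projSpaceStr k V) (q := p) ψ (by
    rw [← cancel_epi (Spec.map ι), ← Spec.map_comp_assoc, hψι, hk, reassoc_of% hι,
      projGeneric_str])
  refine ⟨f, hfp, hdom, fun h => toRationalMap_eq_of_pull_eq ?_⟩
  have hg := isGenericHom_genericι (projSpace k V)
  have ht := isGenericHom_projGeneric k V
  have hge := hg.comp_isIso ((projAction τ).act h)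
  have hpullι : pull f (projGeneric k V) (ht.mem_domain f) = Spec.map Ψ ≫ genericι X := by
    rw [← hψι, Spec.map_comp, Category.assoc, ← hpull,
      comp_pull _ _ _ ((hg.comp_left _).mem_domain f)]
    congr 1
    exact hι.symm
  obtain ⟨a, ha⟩ := exists_functionField_act β h
  have hact : pull f (Spec.map ι ≫ genericι (projSpace k V) ≫ (projAction τ).act h)
      ((hge.comp_left _).mem_domain f) =
      Spec.map (CommRingCat.ofHom (symFracMap τ h)) ≫ Spec.map Ψ ≫ genericι X := by
    rw [← hpullι, comp_pull _ _ _ ((ht.comp_left _).mem_domain f)]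
    congr 1
    rw [reassoc_of% hι, SpecMap_symFracMap_projGeneric]
  rw [pull_precompIso _ _ _ (hge.mem_domain f)]
  refine Eq.trans ?_ (pull_compHom f (hg.mem_domain f) (β.act h)).symm
  rw [← cancel_epi (Spec.map ι), comp_pull _ _ _ ((hge.comp_left _).mem_domain f), hact, hpull,
    Category.assoc, ← ha, ← Spec.map_comp_assoc ψ, ← Spec.map_comp_assoc, ← Spec.map_comp_assoc,
    he h a ha, hψι]

/-- If `X` is dominated equivariantly by `ℙ(V^∨)` and a cyclic subgroup `Z` acts trivially on `X`
and through a faithful character on `W`, then `X` is dominated equivariantly by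
`ℙ((W^{n + 1})^∨)`, where `n = dim V`. -/
theorem existsDominantEquivariantMap_copies [CharZero k] [Finite H] [FiniteDimensional k V]
    [LocallyOfFiniteType p] {β : RightAction H p} {τ : Representation k H V}
    (hf : ExistsDominantEquivariantMap (projAction τ) β) (Z : Subgroup H) [IsCyclic Z]
    (hβ : ∀ z ∈ Z, β.act z = 𝟙 X) {W : Type u} [AddCommGroup W] [Module k W]
    [FiniteDimensional k W] [Nontrivial W] (ρ : Representation k H W) (χ : Z →* kˣ)
    (hχ : Function.Injective χ) (hZ : ∀ (z : Z) (w : W), ρ z w = (χ z : k) • w)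
    (hscalar : ∀ g : H, (∃ c : k, ∀ w, ρ g w = c • w) → g ∈ Z) :
    ExistsDominantEquivariantMap
      (projAction (Representation.directSum fun _ : Fin (Module.finrank k V + 1) => ρ)) β := by
  have : Nontrivial (DirectSum (Fin (Module.finrank k V + 1)) fun _ => W) :=
    (DirectSum.of_injective (β := fun _ : Fin (Module.finrank k V + 1) => W) 0).nontrivial
  obtain ⟨Φ, hΦk, hΦ⟩ := exists_functionField_embedding hf
  obtain ⟨Ψ, hΨ, hΨk, hΨe⟩ := exists_transfer_hom ρ τ Z χ hχ hZ hscalar rfl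
    (K := X.functionField) Φ.hom fun z y => by
      -- As `z` acts trivially on `X`, the identity is its action on the function field, so the
      -- image of `Φ` is fixed by `z`.
      have := hΦ z (𝟙 _) (by rw [hβ z z.2, Spec.map_id, Category.id_comp, Category.comp_id])
      exact congrArg (fun f => f.hom y) this
  obtain ⟨Ψ', hΨ'⟩ : ∃ Ψ' : X.functionField ⟶
      .of (SymFrac k (DirectSum (Fin (Module.finrank k V + 1)) fun _ => W)),
      ∀ y, Ψ'.hom y = Ψ y := ⟨CommRingCat.ofHom Ψ, fun _ => rfl⟩
  refine existsDominantEquivariantMap_of_embedding Ψ' (fun y => hΨ' y ▸ hΨ y) ?_ fun h a ha => ?_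
  · let κ : CommRingCat.of k ⟶ X.functionField := Spec.preimage (genericι X ≫ p)
    have hκ : Spec.map κ = genericι X ≫ p := Spec.map_preimage _
    rw [← hκ, ← Spec.map_comp] at hΦk ⊢
    congr 1
    ext c
    exact (hΨ' _).trans (hΨk c _ (congrArg (fun f => f.hom c) (Spec.map_injective hΦk)))
  · ext y
    refine (congrArg (symFracMap _ h) (hΨ' y)).trans (Eq.trans ?_ (hΨ' _).symm)
    exact hΨe h a.hom (fun y => congrArg (fun f => f.hom y) (hΦ h a ha)) y

end Descent

/-! ### Representations of extensions with the same class -/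

section SameClass

variable {k G : Type u} [Field k] [Group G]

namespace CentralCyclicExtension

lemma exists_cochain_of_cls_eq {E E' : CentralCyclicExtension k G} (h : E'.cls = E.cls) :
    ∃ β : G → kˣ, ∀ g j, E'.χ (E'.factor g j) * β (g * j) = β g * β j * E.χ (E.factor g j) := by
  obtain ⟨b, hb⟩ := (groupCohomology.H2π_eq_iff _ _).mp h
  refine ⟨fun g => (b g).toMul, fun g j => ?_⟩
  have := congrFun hb (g, j)
  change b j - b (g * j) + b g = E'.factorSet (g, j) - E.factorSet (g, j) at this
  apply Additive.ofMul.injective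
  change E'.factorSet (g, j) + b (g * j) = b g + b j + E.factorSet (g, j)
  rw [← sub_eq_zero] at this ⊢
  rw [← neg_eq_zero, ← this]
  abel

variable (E E' : CentralCyclicExtension k G)

/-- The element `x s(π x)⁻¹` of the kernel. -/
def kerPart (x : E.carrier) : E.π.ker :=
  ⟨x * (E.sec (E.π x))⁻¹, by simp [MonoidHom.mem_ker, π_sec]⟩

lemma kerPart_mul (x y : E.carrier) :
    E.kerPart (x * y) = E.kerPart x * E.kerPart y * E.factor (E.π x) (E.π y) := by
  have hc := Subgroup.mem_center_iff.mp (E.central (E.kerPart y).2) (E.sec (E.π x))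
  apply Subtype.ext
  simp only [Subgroup.coe_mul, kerPart, factor, map_mul] at hc ⊢
  calc x * y * (E.sec (E.π x * E.π y))⁻¹
      = x * (E.sec (E.π x))⁻¹ * (E.sec (E.π x) * (y * (E.sec (E.π y))⁻¹)) * E.sec (E.π y) *
        (E.sec (E.π x * E.π y))⁻¹ := by group
    _ = _ := by rw [hc]; group

/-- The section need not send 1 to 1, whence the correction `kerPart 1`. -/
lemma kerPart_ker (z : E.π.ker) : E.kerPart z = z * E.kerPart 1 := by
  apply Subtype.ext
  have hz : E.π z = 1 := z.2
  simp [kerPart, hz]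

lemma rep_sec_mul {W : Type u} [AddCommGroup W] [Module k W] {ρ : Representation k E.carrier W}
    (hker : E.KernelActsByScalars ρ) (g j : G) :
    ρ (E.sec g) * ρ (E.sec j) = (E.χ (E.factor g j) : k) • ρ (E.sec (g * j)) := by
  have : E.sec g * E.sec j = E.factor g j * E.sec (g * j) := by simp [factor]
  rw [← map_mul, this, map_mul]
  ext w
  simp [hker (E.factor g j)]

/-- A representation of an extension on which the kernel acts by scalars through `χ` gives a
projectively equal one of every other extension of the same class. -/
lemma exists_rep_of_cls_eq {W : Type u} [AddCommGroup W] [Module k W] (h : E'.cls = E.cls)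
    {ρ : Representation k E.carrier W} (hker : E.KernelActsByScalars ρ) :
    ∃ ρ' : Representation k E'.carrier W, E'.KernelActsByScalars ρ' ∧
      ∀ x, ∃ c : kˣ, ρ' x = (c : k) • ρ (E.sec (E'.π x)) := by
  obtain ⟨β, hβ⟩ := exists_cochain_of_cls_eq h
  -- The operators `ρ (E.sec g)` multiply up to the factor set of `E`; rescaling by `β` changes it
  -- to that of `E'`, which the factor `χ' (kerPart x)` trivializes on `E'`.
  let r : E'.carrier → Module.End k W := fun x =>
    ((E'.χ (E'.kerPart x) * β (E'.π x) : kˣ) : k) • ρ (E.sec (E'.π x))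
  have hmul : ∀ x y, r (x * y) = r x * r y := by
    intro x y
    simp only [r]
    rw [smul_mul_smul_comm, rep_sec_mul E hker, smul_smul, map_mul, ← Units.val_mul,
      ← Units.val_mul, kerPart_mul, map_mul, map_mul]
    congr 2
    rw [mul_assoc, hβ]
    ac_rfl
  -- The sections are not normalized, so `r 1` is at first only an invertible scalar; being
  -- idempotent, it is 1.
  have hone : r 1 = 1 := by
    have hsec : E.sec 1 ∈ E.π.ker := E.π_sec 1
    have hr : ∃ u : kˣ, r 1 = (u : k) • 1 := by
      refine ⟨E'.χ (E'.kerPart 1) * β 1 * E.χ ⟨_, hsec⟩, ?_⟩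
      ext w
      simp only [r, map_one, LinearMap.smul_apply, Units.val_mul, mul_smul]
      rw [hker ⟨_, hsec⟩ w]
      rfl
    obtain ⟨u, hu⟩ := hr
    have h1 := hmul 1 1
    rw [mul_one] at h1
    have hunit : IsUnit (r 1) := by
      rw [hu]
      exact isUnit_one.smul u
    exact hunit.mul_eq_left.mp h1.symm
  refine ⟨{ toFun := r, map_one' := hone, map_mul' := hmul }, fun z w => ?_, fun x => ⟨_, rfl⟩⟩
  have hz : E'.π z = 1 := z.2
  have : r z = (E'.χ z : k) • r 1 := by
    simp only [r]
    rw [kerPart_ker, hz, map_one, map_mul, smul_smul, mul_assoc, Units.val_mul (E'.χ z)]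
  change r z w = _
  rw [this, hone]
  rfl

end CentralCyclicExtension

/-- Scalars act trivially on projective space, so only the projective classes of the operators
matter. -/
lemma projAction_act_eq_of_smul {H H' V : Type u} [Group H] [Group H'] [AddCommGroup V]
    [Module k V] (σ : Representation k H V) (σ' : Representation k H' V) {x : H} {x' : H'}
    (c : kˣ) (h : σ' x' = (c : k) • σ x) : (projAction σ').act x' = (projAction σ).act x := by
  have e : symMap (σ' x') = (symMap ((c : k) • (LinearMap.id : V →ₗ[k] V))).comp
      (symMap (σ x)) := by
    rw [← symMap_comp, h]
    rfl
  have hc : HomogeneousIdeal.irrelevant (symGrading k V) ≤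
      (HomogeneousIdeal.irrelevant (symGrading k V)).map
        (symMap ((c : k) • (LinearMap.id : V →ₗ[k] V))) :=
    irrelevant_le_map_symMap _ (((c⁻¹ : kˣ) : k) • (LinearMap.id : V →ₗ[k] V)) (by
      ext v
      simp)
  simp only [projAction, e]
  rw [Proj.map_comp _ _ _ hc, projMap_scalar, Category.id_comp]

end SameClass

end

end EquivUnirational

namespace EquivUnirational

/-! ### Change of group -/

/-- A dominant rational map that is equivariant for one group is so for another group acting
through the same automorphisms. -/
lemma ExistsDominantEquivariantMap.of_act_eq {G H : Type u} [Group G] [Group H]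
    {S X Y : Scheme.{u}} {p : X ⟶ S} {q : Y ⟶ S} {α : RightAction G p} {β : RightAction G q}
    {α' : RightAction H p} {β' : RightAction H q} (hf : ExistsDominantEquivariantMap α β)
    (h : ∀ j : H, ∃ g : G, α.act g = α'.act j ∧ β.act g = β'.act j) :
    ExistsDominantEquivariantMap α' β' := by
  obtain ⟨f, hfp, hdom, hfe⟩ := hf
  refine ⟨f, hfp, hdom, fun j => ?_⟩
  obtain ⟨g, hα, hβ⟩ := h j
  have := hfe g
  simp only [hα, hβ] at this
  exact this

end EquivUnirational

/-! ### The equivalence -/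

theorem proposition7p1 {k : Type u} [Field k] [IsAlgClosed k] [CharZero k]
    {G : Type u} [Group G] [Finite G]
    -- a smooth projective rational variety over `k` with a regular `G`-action
    {X : Scheme.{u}} (p : X ⟶ Spec (.of k)) [IsIntegral X] [Smooth p]
    (hproj : EquivUnirational.IsProjectiveOver p) [Scheme.IsRationalOver p]
    (α : EquivUnirational.RightAction G p)
    -- a class, a central cyclic extension of this class, and a representation of positive dimension
    (γ : groupCohomology.H2 (EquivUnirational.unitsRep k G))
    (E : EquivUnirational.CentralCyclicExtension k G) (hE : E.cls = γ)
    {W : Type u} [AddCommGroup W] [Module k W] [FiniteDimensional k W] [Nontrivial W]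
    (ρ : Representation k E.carrier W)
    -- the subgroup acting by scalars is precisely the kernel, acting through roots of unity
    (hscalar : ∀ g : E.carrier, (∃ c : k, ∀ w, ρ g w = c • w) ↔ g ∈ E.π.ker)
    (hker : E.KernelActsByScalars ρ) :
    (∃ E' : EquivUnirational.CentralCyclicExtension k G,
        E'.cls = γ ∧ EquivUnirational.IsUnirational (α.restrict E'.π)) ↔
      ∃ m : ℕ, 0 < m ∧ EquivUnirational.ExistsDominantEquivariantMap
        (E.quotientProjAction (E.copies ρ m) (hker.copies E m)) α := by
  constructor
  · rintro ⟨E', hE', V, _, _, _, τ, hf⟩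
    obtain ⟨ρ', hker', hρ'⟩ := E.exists_rep_of_cls_eq E' (hE'.trans hE.symm) hker
    have := E'.cyclic
    refine ⟨Module.finrank k V + 1, Nat.succ_pos _, ?_⟩
    refine (EquivUnirational.existsDominantEquivariantMap_copies hf E'.π.ker ?_ ρ' E'.χ
      E'.χ_injective hker' ?_).of_act_eq ?_
    · intro z hz
      change α.act (E'.π z) = _
      rw [MonoidHom.mem_ker.mp hz, α.act_one]
    -- If `ρ' x` is scalar, so is its multiple `ρ (E.sec (E'.π x))`; then `E.sec (E'.π x)` lies in
    -- the kernel of `E.π`, which means `E'.π x = 1`.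
    · rintro x ⟨c, hc⟩
      obtain ⟨d, hd⟩ := hρ' x
      have hsec : E.sec (E'.π x) ∈ E.π.ker := by
        refine (hscalar _).mp ⟨((d⁻¹ : kˣ) : k) * c, fun w => ?_⟩
        rw [mul_smul, ← hc w, hd]
        simp [smul_smul]
      rwa [MonoidHom.mem_ker, E.π_sec] at hsec
    -- A lift `x` of `g` to `E'` and the lift `E.sec g` to `E` act by proportional operators, so
    -- both induce the action of `g` on the projective space.
    · intro g
      obtain ⟨x, rfl⟩ := E'.π_surjective g
      obtain ⟨c, hc⟩ := hρ' x
      refine ⟨x, ?_, rfl⟩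
      have hact :=
        (EquivUnirational.projAction (E.copies ρ (Module.finrank k V + 1))).descend_act E.π
          E.π_surjective
          (fun z hz => EquivUnirational.projAction_act_scalar _ z _ (hker.copies E _ ⟨z, hz⟩))
          (E.sec (E'.π x))
      rw [E.π_sec] at hact
      refine Eq.trans ?_ hact.symm
      refine EquivUnirational.projAction_act_eq_of_smul _ _ c ?_
      ext v i
      simp [Representation.directSum, hc, DirectSum.smul_apply]
  · rintro ⟨m, -, hf⟩
    refine ⟨E, hE, DirectSum (Fin m) fun _ => W, inferInstance, inferInstance, inferInstance,
      E.copies ρ m, hf.of_act_eq fun x => ⟨E.π x, ?_, rfl⟩⟩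
    exact EquivUnirational.RightAction.descend_act _ _ _ _ _
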